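/- Let $p\ge 2$, $q\ge 1$, $n=p+q$, let $V=\mathbb R^{p,q}$ be $\mathbb R^n$ with $\mathbf{det}(x)=P(x)=x_1^2+\cdots+x_p^2-x_{p+1}^2-\cdots-x_n^2$, and for $s\in\mathbb C$ put $\mathbf{det}(x)^{s,+}=|P(x)|^s$ and $\mathbf{det}(x)^{s,-}=\operatorname{sign}(P(x))\,|P(x)|^s$. For a Schwartz function $f\in\mathcal S(V)$ and $\varepsilon\in\{+,-\}$ the integral $$Z_\varepsilon(f,s)=\int_V f(x)\,\mathbf{det}(x)^{s,\varepsilon}\,dx$$ converges absolutely for $\operatorname{Re}s>0$ and extends to a meromorphic function of $s$ on $\mathbb C$, again denoted $Z_\varepsilon(f,s)$. Let $\widehat f(x)=\int_V e^{i\langle x,y\rangle}f(y)\,dy$, with $\langle\cdot,\cdot\rangle$ the standard Euclidean inner product and $dy$ the standard Lebesgue measure. Then, for every $f\in\mathcal S(V)$, $$\begin{bmatrix} Z_+(\widehat f,s)\\ Z_-(\widehat f,s)\end{bmatrix} =\gamma(s)\,\mathbf A(s)\begin{bmatrix} Z_+(f,-s-\frac n2)\\ Z_-(f,-s-\frac n2)\end{bmatrix}$$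 as an identity of meromorphic functions of $s\in\mathbb C$ (it holds on a punctured neighbourhood of every point of $\mathbb C$, and at every point $s$ at which neither $\Gamma(s+1)$, $\Gamma(s+\frac n2)$ nor $Z_\pm(f,-s-\frac n2)$ has a pole), where $$\gamma(s)=2^{2s+n}\,\pi^{\frac n2-1}\,\Gamma(s+1)\,\Gamma\!\left(s+\tfrac n2\right)$$ and $$\mathbf A(s)=\begin{bmatrix} \cos\frac{(p-q)\pi}{4}\left(\sin\frac{n\pi}{4}-\sin\left(s+\frac n4\right)\pi\right) & \sin\frac{(p-q)\pi}{4}\left(\cos\left(s+\frac n4\right)\pi-\cos\frac{n\pi}{4}\right)\\ \sin\frac{(p-q)\pi}{4}\left(\cos\left(s+\frac n4\right)\pi+\cos\frac{n\pi}{4}\right) & -\cos\frac{(p-q)\pi}{4}\left(\sin\frac{n\pi}{4}+\sin\left(s+\frac n4\right)\pi\right) \end{bmatrix}.$$ -/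

import Mathlib

open scoped Topology SchwartzMap RealInnerProductSpace

noncomputable section

namespace ZetaPQ

/-- The Euclidean space underlying `ℝ^{p,q}`: the first `p` coordinates are indexed by `Fin p`,
the last `q` coordinates by `Fin q`. The measure `volume` is the standard Lebesgue measure. -/
abbrev V (p q : ℕ) : Type := EuclideanSpace ℝ (Fin p ⊕ Fin q)

/-- The determinant of `ℝ^{p,q}`: `P(x) = x₁² + ⋯ + x_p² - x_{p+1}² - ⋯ - x_n²`. -/
def P {p q : ℕ} (x : V p q) : ℝ :=
  ∑ i : Fin p, x (Sum.inl i) ^ 2 - ∑ j : Fin q, x (Sum.inr j) ^ 2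

/-- The two values `+`, `-` of the parameter `ε`. -/
inductive Parity
  | plus
  | minus

/-- `det(x)^{s,ε}`, that is `|P(x)|^s` for `ε = +` and `sign(P(x)) |P(x)|^s` for `ε = -`. -/
def detPow {p q : ℕ} (ε : Parity) (s : ℂ) (x : V p q) : ℂ :=
  match ε with
  | Parity.plus => ((|P x| : ℝ) : ℂ) ^ s
  | Parity.minus => ((Real.sign (P x) : ℝ) : ℂ) * ((|P x| : ℝ) : ℂ) ^ s

/-- The zeta integral `∫ f(x) det(x)^{s,ε} dx` (meaningful for `Re s > 0`). -/
def zetaIntegral {p q : ℕ} (ε : Parity) (f : 𝓢(V p q, ℂ)) (s : ℂ) : ℂ :=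
  ∫ x, f x * detPow ε s x

/-- `F` is the meromorphic continuation to `ℂ` of the zeta integral. It is required to be in
normal form, i.e. its value at a point which is not a pole is its limit there (and, by convention,
its value at a pole is `0`), so that there is at most one such `F`. -/
def IsZetaContinuation {p q : ℕ} (ε : Parity) (f : 𝓢(V p q, ℂ)) (F : ℂ → ℂ) : Prop :=
  MeromorphicNFOn F Set.univ ∧ ∀ s : ℂ, 0 < s.re → F s = zetaIntegral ε f s

open Classical in
/-- `Z_ε(f, s)` on the whole plane: the meromorphic continuation of the zeta integral. -/
def Z {p q : ℕ} (ε : Parity) (f : 𝓢(V p q, ℂ)) : ℂ → ℂ :=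
  if h : ∃ F : ℂ → ℂ, IsZetaContinuation ε f F then h.choose else zetaIntegral ε f

/-- The dilation `x ↦ -(2π)⁻¹ x` of `ℝ^n`. -/
def dil (p q : ℕ) : V p q ≃L[ℝ] V p q :=
  ContinuousLinearEquiv.smulLeft
    (Units.mk0 (-(2 * Real.pi)⁻¹ : ℝ) (neg_ne_zero.2 (inv_ne_zero Real.two_pi_pos.ne')))

/-- The Fourier transform `f̂(x) = ∫ e^{i⟨x,y⟩} f(y) dy` of a Schwartz function, as a Schwartz
function; see `fhat_apply` for the integral formula. -/
def fhat {p q : ℕ} (f : 𝓢(V p q, ℂ)) : 𝓢(V p q, ℂ) :=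
  SchwartzMap.compCLMOfContinuousLinearEquiv ℝ (dil p q)
    (FourierTransform.fourier f : 𝓢(V p q, ℂ))

theorem fhat_apply {p q : ℕ} (f : 𝓢(V p q, ℂ)) (x : V p q) :
    fhat f x = ∫ y, Complex.exp (Complex.I * ((⟪x, y⟫ : ℝ) : ℂ)) * f y := by
  change (FourierTransform.fourier f : 𝓢(V p q, ℂ)) ((-(2 * Real.pi)⁻¹ : ℝ) • x) = _
  rw [SchwartzMap.fourier_coe, Real.fourier_eq']
  refine MeasureTheory.integral_congr_ae (Filter.Eventually.of_forall fun y => ?_)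
  have h : -2 * Real.pi * ⟪y, (-(2 * Real.pi)⁻¹ : ℝ) • x⟫ = ⟪x, y⟫ := by
    rw [real_inner_smul_right, real_inner_comm]
    field_simp
  simp only [h, smul_eq_mul]
  rw [mul_comm Complex.I]

/-- `γ(s) = 2^{2s+n} π^{n/2-1} Γ(s+1) Γ(s+n/2)`. -/
def γ (n : ℕ) (s : ℂ) : ℂ :=
  (2 : ℂ) ^ (2 * s + n) * (Real.pi : ℂ) ^ ((n : ℂ) / 2 - 1) *
    Complex.Gamma (s + 1) * Complex.Gamma (s + (n : ℂ) / 2)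

/-- The matrix `A(s)`, with `n = p + q`. -/
def A (p q : ℕ) (s : ℂ) : Matrix (Fin 2) (Fin 2) ℂ :=
  let n : ℂ := (p : ℂ) + q
  let d : ℂ := ((p : ℂ) - q) * Real.pi / 4
  let a : ℂ := n * Real.pi / 4
  let b : ℂ := (s + n / 4) * Real.pi
  !![Complex.cos d * (Complex.sin a - Complex.sin b),
     Complex.sin d * (Complex.cos b - Complex.cos a);
     Complex.sin d * (Complex.cos b + Complex.cos a),
     -(Complex.cos d * (Complex.sin a + Complex.sin b))]

/-- The functional equation at the point `s`. -/
def FunctionalEquation {p q : ℕ} (f : 𝓢(V p q, ℂ)) (s : ℂ) : Prop :=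
  ![Z Parity.plus (fhat f) s, Z Parity.minus (fhat f) s] =
    γ (p + q) s • (A p q s).mulVec
      ![Z Parity.plus f (-s - ((p + q : ℕ) : ℂ) / 2),
        Z Parity.minus f (-s - ((p + q : ℕ) : ℂ) / 2)]

end ZetaPQ

end

/-! Put I_f(r) = ∫ f e^{irP}. Fubini and the Fourier transform of the Gaussians exp(-∑ b_i x_i²), in
the limit b_i → ∓ir, give for σ = ±1 and t > 0 I_{f̂}(σt/2) = c_σ t^{-n/2} I_f(-σ/(2t)), with c_σ =
(2π)^{n/2} e^{iσ(p-q)π/4} (`oscIntegral_fhat`). This plays the role of theta inversion in Riemann's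
proof for ζ. In the Mellin transform in t, split at t = 1, the inversion folds the tail back to
(0,1], where a Taylor expansion at 0 provides the continuation. The result is a meromorphic function
M_f(σ,z) (`oscMellin`) with M_{f̂}(σ,z) = c_σ M_f(-σ, n/2 - z) (`oscMellin_fhat`).

In the strip -1 < Re z < 0 the function M_f(σ,z) is the Mellin transform of I_f(σt/2) - ∫f. Fubini
and the Mellin transform of e^{iut} - 1 turn it into Γ(z) 2^z (cos(πz/2) Z_+(f,-z) + iσ sin(πz/2)
Z_-(f,-z)) (`oscMellin_eq_zetaIntegral`). The two signs σ form an invertible linear system. Solving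
it continues Z_± (`zetaExt`) and turns the scalar equation for M into the matrix equation: the
reflection formula for Γ produces γ, and the addition formulas produce the entries of A. The
signature enters the constants only through n and the phase of c_σ. -/

namespace ZetaPQ

open MeasureTheory Set Filter Asymptotics

/-! ### Mellin transforms over (0,1] and their continuation -/

/-- The function `φ` on `(0, 1]` minus its expansion `∑ j < m, c j * t ^ j`, extended by zero. -/
noncomputable def cutRemainder (φ : ℝ → ℂ) (c : ℕ → ℂ) (m : ℕ) : ℝ → ℂ :=
  indicator (Ioc 0 1) fun t => φ t - ∑ j ∈ Finset.range m, c j * (t : ℂ) ^ j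

/-- The continuation of `∫ t in (0, 1], t ^ (s - 1) * φ t` to the half-plane `-m < re s`. -/
noncomputable def mellinCutStep (φ : ℝ → ℂ) (c : ℕ → ℂ) (m : ℕ) (s : ℂ) : ℂ :=
  ∑ j ∈ Finset.range m, c j / (s + j) + mellin (cutRemainder φ c m) s

/-- The meromorphic continuation of `∫ t in (0, 1], t ^ (s - 1) * φ t` to the plane. -/
noncomputable def mellinCut (φ : ℝ → ℂ) (c : ℕ → ℂ) (s : ℂ) : ℂ :=
  mellinCutStep φ c (⌊-s.re⌋₊ + 1) s

/-- `φ` is continuous and has the asymptotic expansion `∑ c j * t ^ j` at `0` from the right. -/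
structure HasExpansion (φ : ℝ → ℂ) (c : ℕ → ℂ) : Prop where
  continuous : Continuous φ
  bound : ∀ m : ℕ, ∃ C : ℝ, ∀ t ∈ Ioc (0 : ℝ) 1,
    ‖φ t - ∑ j ∈ Finset.range m, c j * (t : ℂ) ^ j‖ ≤ C * t ^ m

namespace HasExpansion

variable {φ : ℝ → ℂ} {c : ℕ → ℂ}

theorem locallyIntegrableOn_cutRemainder (h : HasExpansion φ c) (m : ℕ) :
    LocallyIntegrableOn (cutRemainder φ c m) (Ioi 0) := by
  have hc : Continuous fun t : ℝ => φ t - ∑ j ∈ Finset.range m, c j * (t : ℂ) ^ j :=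
    h.continuous.sub (by fun_prop)
  exact (hc.locallyIntegrable.indicator measurableSet_Ioc).locallyIntegrableOn _

theorem cutRemainder_isBigO_atTop (m : ℕ) (a : ℝ) :
    cutRemainder φ c m =O[atTop] fun t : ℝ => t ^ (-a) := by
  refine EventuallyEq.trans_isBigO ?_ (isBigO_zero _ _)
  filter_upwards [eventually_gt_atTop 1] with t ht
  simp [cutRemainder, ht]

theorem cutRemainder_isBigO_zero (h : HasExpansion φ c) (m : ℕ) :
    cutRemainder φ c m =O[𝓝[>] 0] fun t : ℝ => t ^ (-(-m : ℝ)) := by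
  obtain ⟨C, hC⟩ := h.bound m
  refine IsBigO.of_bound C ?_
  filter_upwards [Ioc_mem_nhdsGT one_pos] with t ht
  rw [cutRemainder, indicator_of_mem ht, neg_neg, Real.rpow_natCast,
    Real.norm_of_nonneg (pow_nonneg ht.1.le _)]
  exact hC t ht

theorem mellinConvergent_cutRemainder (h : HasExpansion φ c) {m : ℕ} {s : ℂ}
    (hs : -(m : ℝ) < s.re) : MellinConvergent (cutRemainder φ c m) s :=
  mellinConvergent_of_isBigO_rpow (h.locallyIntegrableOn_cutRemainder m)
    (cutRemainder_isBigO_atTop m _) (lt_add_one s.re) (h.cutRemainder_isBigO_zero m) hs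

theorem differentiableAt_mellin_cutRemainder (h : HasExpansion φ c) {m : ℕ} {s : ℂ}
    (hs : -(m : ℝ) < s.re) : DifferentiableAt ℂ (mellin (cutRemainder φ c m)) s :=
  mellin_differentiableAt_of_isBigO_rpow (h.locallyIntegrableOn_cutRemainder m)
    (cutRemainder_isBigO_atTop m _) (lt_add_one s.re) (h.cutRemainder_isBigO_zero m) hs

/-- Moving the monomial `c m * t ^ m` from the remainder to the sum costs exactly its own Mellin
integral `c m / (s + m)`, convergent for `-m < re s`. -/
theorem mellinCutStep_succ (h : HasExpansion φ c) {m : ℕ} {s : ℂ} (hs : -(m : ℝ) < s.re) :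
    mellinCutStep φ c (m + 1) s = mellinCutStep φ c m s := by
  have hpow := hasMellin_cpow_Ioc (m : ℂ) (s := s) (by simpa using (by linarith : 0 < s.re + m))
  have key : cutRemainder φ c (m + 1) = fun t => cutRemainder φ c m t -
      c m • indicator (Ioc 0 1) (fun t : ℝ => (t : ℂ) ^ (m : ℂ)) t := by
    funext t
    by_cases ht : t ∈ Ioc (0 : ℝ) 1
    · simp only [cutRemainder, indicator_of_mem ht, Finset.sum_range_succ, Complex.cpow_natCast,
        smul_eq_mul]
      ring
    · simp only [cutRemainder, indicator_of_notMem ht, smul_zero, sub_zero]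
  have h2 := hasMellin_sub (h.mellinConvergent_cutRemainder hs)
    (hasMellin_const_smul hpow.1 (c m)).1
  rw [mellinCutStep, mellinCutStep, key, h2.2, (hasMellin_const_smul hpow.1 (c m)).2, hpow.2,
    Finset.sum_range_succ, smul_eq_mul]
  ring

theorem mellinCutStep_of_le (h : HasExpansion φ c) {m k : ℕ} (hmk : m ≤ k) {s : ℂ}
    (hs : -(m : ℝ) < s.re) : mellinCutStep φ c k s = mellinCutStep φ c m s := by
  induction k, hmk using Nat.le_induction with
  | base => rfl
  | succ k hk ih =>
    rw [h.mellinCutStep_succ, ih]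
    have : (m : ℝ) ≤ k := by exact_mod_cast hk
    linarith

theorem mellinCut_eq_step (h : HasExpansion φ c) {m : ℕ} {s : ℂ} (hs : -(m : ℝ) < s.re) :
    mellinCut φ c s = mellinCutStep φ c m s := by
  have h1 : -((⌊-s.re⌋₊ + 1 : ℕ) : ℝ) < s.re := by
    have := Nat.lt_floor_add_one (-s.re)
    push_cast
    linarith
  rw [mellinCut]
  rcases le_total (⌊-s.re⌋₊ + 1) m with hm | hm
  · exact (h.mellinCutStep_of_le hm h1).symm
  · exact h.mellinCutStep_of_le hm hs

theorem meromorphicAt_mellinCut (h : HasExpansion φ c) (s : ℂ) :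
    MeromorphicAt (mellinCut φ c) s := by
  -- The order used by `mellinCut` jumps with `re z`; one fixed large order serves a whole
  -- neighbourhood of `s`.
  obtain ⟨m, hm⟩ := exists_nat_gt (-s.re)
  have hopen : IsOpen {z : ℂ | -(m : ℝ) < z.re} := isOpen_lt continuous_const Complex.continuous_re
  have hmem : {z : ℂ | -(m : ℝ) < z.re} ∈ 𝓝 s := hopen.mem_nhds (by simpa using by linarith)
  have hd : AnalyticAt ℂ (mellin (cutRemainder φ c m)) s :=
    (DifferentiableOn.analyticAt (s := {z : ℂ | -(m : ℝ) < z.re})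
      (fun z hz => (h.differentiableAt_mellin_cutRemainder hz).differentiableWithinAt) hmem)
  have hm2 : MeromorphicAt (mellinCutStep φ c m) s := by
    refine MeromorphicAt.add (MeromorphicAt.fun_sum fun j => ?_) hd.meromorphicAt
    fun_prop
  refine hm2.congr ?_
  filter_upwards [nhdsWithin_le_nhds hmem] with z hz
  exact (h.mellinCut_eq_step hz).symm

theorem mellinCut_of_re_pos (h : HasExpansion φ c) {s : ℂ} (hs : 0 < s.re) :
    mellinCut φ c s = mellin (indicator (Ioc 0 1) φ) s := by
  rw [h.mellinCut_eq_step (m := 0) (by simpa using hs)]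
  simp [mellinCutStep, cutRemainder]

theorem mellinCut_of_re_gt_neg_one (h : HasExpansion φ c) {s : ℂ} (hs : -1 < s.re) :
    mellinCut φ c s =
      c 0 / s + mellin (indicator (Ioc 0 1) fun t => φ t - c 0) s := by
  rw [h.mellinCut_eq_step (m := 1) (by simpa using hs)]
  simp [mellinCutStep, cutRemainder]

/-- If `φ t = r * t ^ (-k) * ψ t⁻¹`, then `∫ t in (0, ∞), t ^ (z - 1) * (φ t - φ 0)`
is computed by the continued Mellin transforms of `φ` and of `ψ`. -/
theorem mellin_sub_const {ψ : ℝ → ℂ} {d : ℕ → ℂ} (h : HasExpansion φ c) (h' : HasExpansion ψ d)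
    {k : ℝ} (hk : 0 < k) {r : ℂ} (hφψ : ∀ t : ℝ, 0 < t → φ t = r * ((t : ℂ) ^ (-k : ℂ) * ψ t⁻¹))
    {z : ℂ} (hz : -1 < z.re) (hz' : z.re < 0) :
    mellin (fun t => φ t - c 0) z = mellinCut φ c z + r * mellinCut ψ d (k - z) := by
  have hkz : 0 < (k - z).re := by simp; linarith
  rw [h.mellinCut_of_re_gt_neg_one hz, h'.mellinCut_of_re_pos hkz]
  have hconv : ∀ {f : ℝ → ℂ} {w : ℂ}, MellinConvergent f (-w) →
      MellinConvergent (fun t => f t⁻¹) w := by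
    intro f w hf
    have := (MellinConvergent.comp_rpow (f := f) (s := w) (a := -1) (by norm_num)).2
      (by simpa [div_neg] using hf)
    simpa only [Real.rpow_neg_one] using this
  have hA : MellinConvergent (indicator (Ioc 0 1) fun t => φ t - c 0) z := by
    have := h.mellinConvergent_cutRemainder (m := 1) (s := z) (by simpa using hz)
    simpa [cutRemainder] using! this
  have hψ : MellinConvergent (indicator (Ioc 0 1) ψ) (k - z) := by
    have := h'.mellinConvergent_cutRemainder (m := 0) (s := k - z) (by simpa using hkz)
    simpa [cutRemainder] using! this
  have hB1 : MellinConvergent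
      (fun t : ℝ => (t : ℂ) ^ (-k : ℂ) • indicator (Ioc 0 1) ψ t⁻¹) z := by
    rw [MellinConvergent.cpow_smul (f := fun t => indicator (Ioc 0 1) ψ t⁻¹)]
    exact hconv (by simpa [neg_add_rev, sub_eq_add_neg] using hψ)
  -- The constant subtracted on `(1, ∞)` converges because `re z < 0`; its contribution `c 0 / z` is
  -- the pole term of `mellinCut φ c z`.
  have hone := hasMellin_one_Ioc (s := -z) (by simpa using hz')
  have hB2 := hconv hone.1
  have hB := hasMellin_sub (hasMellin_const_smul hB1 r).1 (hasMellin_const_smul hB2 (c 0)).1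
  have hAB := hasMellin_add hA hB.1
  have hcongr : mellin (fun t => φ t - c 0) z = mellin (fun t =>
      indicator (Ioc 0 1) (fun t => φ t - c 0) t +
        (r • ((t : ℂ) ^ (-k : ℂ) • indicator (Ioc 0 1) ψ t⁻¹) -
          c 0 • indicator (Ioc (0 : ℝ) 1) (fun _ => (1 : ℂ)) t⁻¹)) z := by
    refine setIntegral_congr_ae measurableSet_Ioi ?_
    -- Both `t` and `t⁻¹` lie in `(0, 1]` when `t = 1`, so the splitting holds only almost
    -- everywhere.
    have hne : ∀ᵐ t : ℝ, t ≠ 1 := by simp [ae_iff]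
    filter_upwards [hne] with t ht1 ht
    have ht0 : 0 < t := ht
    congr 1
    rcases lt_or_gt_of_ne ht1 with hlt | hgt
    · have h1 : t ∈ Ioc (0 : ℝ) 1 := ⟨ht0, hlt.le⟩
      have h2 : t⁻¹ ∉ Ioc (0 : ℝ) 1 := fun hh => absurd hh.2 (not_le.2 ((one_lt_inv₀ ht0).2 hlt))
      simp [indicator_of_mem h1, indicator_of_notMem h2]
    · have h1 : t ∉ Ioc (0 : ℝ) 1 := fun hh => absurd hh.2 (not_le.2 hgt)
      have h2 : t⁻¹ ∈ Ioc (0 : ℝ) 1 := ⟨inv_pos.2 ht0, inv_le_one_of_one_le₀ hgt.le⟩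
      simp [indicator_of_notMem h1, indicator_of_mem h2, hφψ t ht0]
  rw [hcongr, hAB.2, hB.2, (hasMellin_const_smul hB1 r).2, (hasMellin_const_smul hB2 (c 0)).2,
    mellin_cpow_smul, mellin_comp_inv, mellin_comp_inv, hone.2,
    show -(z + -(k : ℂ)) = k - z by ring, smul_eq_mul, smul_eq_mul]
  have hz0 : z ≠ 0 := by rintro rfl; simp at hz'
  field_simp
  ring

end HasExpansion

/-! ### Gamma integrals and the Mellin transform of e^{iut} - 1 -/

theorem integrableOn_rpow_mul_exp_neg_mul {σ b : ℝ} (hσ : -1 < σ) (hb : 0 < b) :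
    IntegrableOn (fun t : ℝ => t ^ σ * Real.exp (-b * t)) (Ioi 0) := by
  simpa using integrableOn_rpow_mul_exp_neg_mul_rpow (p := 1) hσ one_pos hb

/-- The Gamma integral with a complex parameter. -/
theorem integral_cpow_mul_exp_neg_mul_complex {w a : ℂ} (hw : 0 < w.re) (ha : 0 < a.re) :
    ∫ t in Ioi (0 : ℝ), (t : ℂ) ^ (w - 1) * Complex.exp (-a * t) =
      a ^ (-w) * Complex.Gamma w := by
  set K : ℂ → ℂ := fun a => ∫ t in Ioi (0 : ℝ), (t : ℂ) ^ (w - 1) * Complex.exp (-a * t) with hK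
  have hopen : IsOpen {z : ℂ | 0 < z.re} := isOpen_lt continuous_const Complex.continuous_re
  have hnorm : ∀ (v b : ℂ) (t : ℝ), 0 < t →
      ‖(t : ℂ) ^ v * Complex.exp (-b * t)‖ = t ^ v.re * Real.exp (-b.re * t) := by
    intro v b t ht
    rw [norm_mul, Complex.norm_cpow_eq_rpow_re_of_pos ht, Complex.norm_exp]
    simp
  have hmeas : ∀ v b : ℂ, AEStronglyMeasurable
      (fun t : ℝ => (t : ℂ) ^ v * Complex.exp (-b * t)) (volume.restrict (Ioi 0)) := by
    intro v b
    refine ContinuousOn.aestronglyMeasurable (fun t ht => ?_) measurableSet_Ioi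
    exact ((Complex.continuousAt_ofReal_cpow_const _ _ (Or.inr (ne_of_gt ht))).mul
      (by fun_prop)).continuousWithinAt
  have hint : ∀ v b : ℂ, -1 < v.re → 0 < b.re → Integrable
      (fun t : ℝ => (t : ℂ) ^ v * Complex.exp (-b * t)) (volume.restrict (Ioi 0)) := by
    intro v b hv hb
    refine (integrableOn_rpow_mul_exp_neg_mul hv hb).mono' (hmeas v b) ?_
    filter_upwards [ae_restrict_mem measurableSet_Ioi] with t ht
    exact (hnorm v b t ht).le
  have hdiff : ∀ b : ℂ, 0 < b.re → DifferentiableAt ℂ K b := by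
    intro b hb
    have hs : {z : ℂ | b.re / 2 < z.re} ∈ 𝓝 b :=
      (isOpen_lt continuous_const Complex.continuous_re).mem_nhds (by simpa using hb)
    refine (hasDerivAt_integral_of_dominated_loc_of_deriv_le
      (bound := fun t : ℝ => t ^ w.re * Real.exp (-(b.re / 2) * t))
      (F := fun b t => (t : ℂ) ^ (w - 1) * Complex.exp (-b * t))
      (F' := fun b t => -((t : ℂ) ^ w * Complex.exp (-b * t))) hs
      (Eventually.of_forall fun x => hmeas _ _) (hint _ _ (by simpa using hw) hb)
      (hmeas _ _).neg ?_ (integrableOn_rpow_mul_exp_neg_mul (by linarith) (by linarith))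
      ?_).2.differentiableAt
    · filter_upwards [ae_restrict_mem measurableSet_Ioi] with t ht x hx
      rw [norm_neg, hnorm _ _ _ ht]
      have ht0 : 0 < t := ht
      have hx' : b.re / 2 < x.re := hx
      gcongr
    · filter_upwards [ae_restrict_mem measurableSet_Ioi] with t ht x hx
      have ht0 : (t : ℂ) ≠ 0 := by exact_mod_cast (ne_of_gt ht)
      have h1 : HasDerivAt (fun b : ℂ => -b * (t : ℂ)) (-1 * t) x :=
        ((hasDerivAt_id x).neg).mul_const _
      refine ((h1.cexp).const_mul ((t : ℂ) ^ (w - 1))).congr_deriv ?_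
      rw [Complex.cpow_sub _ _ ht0, Complex.cpow_one]
      field_simp
  have hKan : AnalyticOnNhd ℂ K {z | 0 < z.re} :=
    DifferentiableOn.analyticOnNhd (fun z hz => (hdiff z hz).differentiableWithinAt) hopen
  have hRan : AnalyticOnNhd ℂ (fun a : ℂ => a ^ (-w) * Complex.Gamma w) {z | 0 < z.re} := by
    refine DifferentiableOn.analyticOnNhd (fun z hz => ?_) hopen
    have hz' : z ∈ Complex.slitPlane := Or.inl hz
    exact ((differentiableAt_id.cpow_const hz').mul_const _).differentiableWithinAt
  have hreal : ∀ r : ℝ, 0 < r → K r = (r : ℂ) ^ (-w) * Complex.Gamma w := by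
    intro r hr
    have := Complex.integral_cpow_mul_exp_neg_mul_Ioi hw hr
    rw [one_div, Complex.inv_cpow _ _ (by simp [Complex.arg_ofReal_of_nonneg hr.le, Real.pi_pos.ne]),
      ← Complex.cpow_neg] at this
    rw [← this, hK]
    simp only [neg_mul]
  -- Both sides are analytic in `a` on the right half-plane and agree for real `a > 0`, in
  -- particular at the points `1 + 1/(n+1)`, which accumulate at 1.
  refine hKan.eqOn_of_preconnected_of_frequently_eq hRan
    (convex_halfSpace_re_gt 0).isPreconnected (z₀ := 1) (by simp) ?_ ha
  have htend : Tendsto (fun n : ℕ => (((1 : ℝ) + 1 / ((n : ℝ) + 1) : ℝ) : ℂ)) atTop (𝓝[≠] 1) := by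
    refine tendsto_nhdsWithin_iff.2 ⟨?_, Eventually.of_forall fun n => ?_⟩
    · have := (tendsto_one_div_add_atTop_nhds_zero_nat (𝕜 := ℝ)).const_add 1
      rw [add_zero] at this
      exact_mod_cast (Complex.continuous_ofReal.tendsto _).comp this
    · have : (0 : ℝ) < 1 / ((n : ℝ) + 1) := by positivity
      rw [mem_compl_iff, mem_singleton_iff, Complex.ofReal_eq_one]
      linarith
  exact htend.frequently (Eventually.of_forall fun n => hreal _ (by positivity)).frequently

theorem norm_exp_sub_one_le_of_re_nonpos {z : ℂ} (hz : z.re ≤ 0) :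
    ‖Complex.exp z - 1‖ ≤ min 2 ‖z‖ := by
  refine le_min ?_ ?_
  · refine (norm_sub_le _ _).trans ?_
    rw [Complex.norm_exp, norm_one]
    linarith [Real.exp_le_one_iff.2 hz]
  · have := Convex.norm_image_sub_le_of_norm_hasDerivWithin_le (f := Complex.exp)
      (f' := Complex.exp) (C := 1) (s := {w : ℂ | w.re ≤ 0}) (x := 0) (y := z)
      (fun x _ => (Complex.hasDerivAt_exp x).hasDerivWithinAt)
      (fun x hx => by rw [Complex.norm_exp]; exact Real.exp_le_one_iff.2 hx)
      (convex_halfSpace_re_le 0) (by simp) hz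
    simpa using this

/-- `min 2 t` is `t` near 0 and constant at infinity, whence the strip. This is the majorant for the
passage to imaginary exponents and for Fubini in `oscMellin_eq_zetaIntegral`. -/
theorem integrableOn_rpow_mul_min {σ : ℝ} (hσ : -1 < σ) (hσ' : σ < 0) :
    IntegrableOn (fun t : ℝ => t ^ (σ - 1) * min 2 t) (Ioi 0) := by
  have hc : Continuous fun t : ℝ => min 2 t := by fun_prop
  refine mellin_convergent_of_isBigO_scalar (a := 0) (b := -1)
    (hc.locallyIntegrable.locallyIntegrableOn _) ?_ hσ' ?_ hσ
  · refine IsBigO.of_bound 2 ?_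
    filter_upwards [eventually_gt_atTop 0] with t ht
    have : 0 ≤ min 2 t := le_min (by norm_num) ht.le
    simp [abs_of_nonneg this]
  · refine IsBigO.of_bound 1 ?_
    filter_upwards [self_mem_nhdsWithin] with t ht
    have ht0 : 0 < t := ht
    have : 0 ≤ min 2 t := le_min (by norm_num) ht0.le
    simp [abs_of_nonneg this, abs_of_pos ht0]

theorem norm_exp_neg_mul_sub_one_le {a : ℂ} (ha : 0 ≤ a.re) {t : ℝ} (ht : 0 ≤ t) :
    ‖Complex.exp (-a * t) - 1‖ ≤ (1 + ‖a‖) * min 2 t := by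
  have h := norm_exp_sub_one_le_of_re_nonpos (z := -a * t) (by simpa using mul_nonneg ha ht)
  rw [norm_mul, norm_neg, Complex.norm_of_nonneg ht] at h
  have ha0 := norm_nonneg a
  rcases le_total 2 t with h2 | h2
  · rw [min_eq_left h2]
    linarith [h.trans (min_le_left _ _)]
  · rw [min_eq_right h2]
    linarith [h.trans (min_le_right _ _)]

theorem norm_cpow_mul_exp_neg_mul_sub_one_le {a : ℂ} (ha : 0 ≤ a.re) (z : ℂ) {t : ℝ} (ht : 0 < t) :
    ‖(t : ℂ) ^ (z - 1) * (Complex.exp (-a * t) - 1)‖ ≤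
      (1 + ‖a‖) * (t ^ (z.re - 1) * min 2 t) := by
  rw [norm_mul, Complex.norm_cpow_eq_rpow_re_of_pos ht, Complex.sub_re, Complex.one_re,
    mul_left_comm]
  exact mul_le_mul_of_nonneg_left (norm_exp_neg_mul_sub_one_le ha ht.le) (by positivity)

theorem aestronglyMeasurable_cpow_mul_exp_neg_mul_sub_one (z a : ℂ) :
    AEStronglyMeasurable (fun t : ℝ => (t : ℂ) ^ (z - 1) * (Complex.exp (-a * t) - 1))
      (volume.restrict (Ioi 0)) := by
  refine ContinuousOn.aestronglyMeasurable (fun t ht => ?_) measurableSet_Ioi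
  exact ((Complex.continuousAt_ofReal_cpow_const _ _ (Or.inr (ne_of_gt ht))).mul
    (by fun_prop)).continuousWithinAt

theorem integrableOn_cpow_mul_exp_neg_mul_sub_one {z a : ℂ} (hz : -1 < z.re) (hz' : z.re < 0)
    (ha : 0 ≤ a.re) :
    IntegrableOn (fun t : ℝ => (t : ℂ) ^ (z - 1) * (Complex.exp (-a * t) - 1)) (Ioi 0) := by
  refine ((integrableOn_rpow_mul_min hz hz').const_mul (1 + ‖a‖)).mono'
    (aestronglyMeasurable_cpow_mul_exp_neg_mul_sub_one z a) ?_
  filter_upwards [ae_restrict_mem measurableSet_Ioi] with t ht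
  exact norm_cpow_mul_exp_neg_mul_sub_one_le ha z ht

/-- The regularized Gamma integral in the strip `-1 < re z < 0`, with `0 < re a`. -/
theorem integral_cpow_mul_exp_neg_mul_sub_one {z a : ℂ} (hz : -1 < z.re) (hz' : z.re < 0)
    (ha : 0 < a.re) :
    ∫ t in Ioi (0 : ℝ), (t : ℂ) ^ (z - 1) * (Complex.exp (-a * t) - 1) =
      a ^ (-z) * Complex.Gamma z := by
  have hz0 : z ≠ 0 := by rintro rfl; simp at hz'
  have ha0 : a ≠ 0 := by rintro rfl; simp at ha
  have hw : 0 < (z + 1).re := by simpa using (by linarith : 0 < z.re + 1)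
  have hG := integral_cpow_mul_exp_neg_mul_complex hw ha
  rw [add_sub_cancel_right] at hG
  have hGint : IntegrableOn (fun t : ℝ => (t : ℂ) ^ z * Complex.exp (-a * t)) (Ioi 0) := by
    -- A non-integrable function would have integral 0 by default, whereas the value in `hG` is
    -- nonzero.
    by_contra hcon
    rw [integral_undef hcon] at hG
    have := mul_ne_zero ((Complex.cpow_ne_zero_iff_of_exponent_ne_zero (y := -(z + 1))
      (fun h => by
        have := congrArg Complex.re h
        simp at this hw
        linarith)).2 ha0) (Complex.Gamma_ne_zero_of_re_pos hw)
    exact this hG.symm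
  have hbound : ∀ t : ℝ, 0 < t → ‖(Complex.exp (-a * t) - 1) * ((t : ℂ) ^ z / z)‖ ≤
      (1 + ‖a‖) / ‖z‖ * (t ^ z.re * min 2 t) := by
    intro t ht
    rw [norm_mul, norm_div, Complex.norm_cpow_eq_rpow_re_of_pos ht]
    calc _ ≤ ((1 + ‖a‖) * min 2 t) * (t ^ z.re / ‖z‖) :=
          mul_le_mul_of_nonneg_right (norm_exp_neg_mul_sub_one_le ha.le ht.le) (by positivity)
      _ = _ := by ring
  -- Integration by parts against `t ^ z / z` reduces to the Gamma integral at `z + 1`. The boundary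
  -- terms are `O(t ^ (re z + 1))` at 0 and `O(t ^ re z)` at infinity.
  have hparts := integral_Ioi_mul_deriv_eq_deriv_mul (a := 0) (a' := 0) (b' := 0)
    (u := fun t : ℝ => Complex.exp (-a * t) - 1) (v := fun t : ℝ => (t : ℂ) ^ z / z)
    (u' := fun t : ℝ => -a * Complex.exp (-a * t)) (v' := fun t : ℝ => (t : ℂ) ^ (z - 1))
    (fun t _ => by
      have h1 : HasDerivAt (fun t : ℝ => -a * (t : ℂ)) (-a * 1) t :=
        (Complex.ofRealCLM.hasDerivAt (x := t)).const_mul _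
      refine (h1.cexp.sub_const 1).congr_deriv ?_
      ring)
    (fun t ht => by
      have := (hasDerivAt_ofReal_cpow_const (x := t) (r := z) (ne_of_gt ht) hz0).div_const z
      rwa [mul_div_cancel_left₀ _ hz0] at this)
    (by
      refine (integrableOn_cpow_mul_exp_neg_mul_sub_one hz hz' ha.le).congr_fun (fun t _ => ?_)
        measurableSet_Ioi
      simp only [Pi.mul_apply]
      ring)
    (by
      refine IntegrableOn.congr_fun (hGint.const_mul (-a / z)) (fun t _ => ?_) measurableSet_Ioi
      simp only [Pi.mul_apply]
      ring)
    (by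
      refine squeeze_zero_norm' (a := fun t : ℝ => (1 + ‖a‖) / ‖z‖ * t ^ (z.re + 1)) ?_ ?_
      · filter_upwards [self_mem_nhdsWithin] with t ht
        have ht0 : 0 < t := ht
        refine (hbound t ht).trans ?_
        rw [Real.rpow_add_one ht0.ne']
        gcongr
        exact min_le_right _ _
      · have h1 : Tendsto (fun t : ℝ => t ^ (z.re + 1)) (𝓝[>] 0) (𝓝 0) := by
          have := (Real.continuousAt_rpow_const 0 (z.re + 1) (Or.inr (by linarith))).tendsto
          rw [Real.zero_rpow (by linarith)] at this
          exact this.mono_left nhdsWithin_le_nhds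
        simpa using h1.const_mul ((1 + ‖a‖) / ‖z‖))
    (by
      refine squeeze_zero_norm' (a := fun t : ℝ => (1 + ‖a‖) / ‖z‖ * (t ^ z.re * 2)) ?_ ?_
      · filter_upwards [eventually_gt_atTop 0] with t ht
        refine (hbound t ht).trans ?_
        gcongr
        exact min_le_left _ _
      · have h1 := tendsto_rpow_neg_atTop (y := -z.re) (by linarith)
        rw [neg_neg] at h1
        simpa using (h1.mul_const 2).const_mul ((1 + ‖a‖) / ‖z‖))
  have e1 : ∫ t in Ioi (0 : ℝ), (t : ℂ) ^ (z - 1) * (Complex.exp (-a * t) - 1) =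
      ∫ t in Ioi (0 : ℝ), (Complex.exp (-a * t) - 1) * (t : ℂ) ^ (z - 1) := by
    simp only [mul_comm]
  have e2 : ∫ t in Ioi (0 : ℝ), -a * Complex.exp (-a * t) * ((t : ℂ) ^ z / z) =
      -a / z * (a ^ (-(z + 1)) * Complex.Gamma (z + 1)) := by
    rw [← hG, ← integral_const_mul]
    congr 1
    funext t
    ring
  rw [e1, hparts, e2, Complex.Gamma_add_one z hz0, neg_add, Complex.cpow_add _ _ ha0,
    Complex.cpow_neg_one]
  field_simp
  ring

/-- Limit `ε → 0⁺` at `a = ε - iu`. Subtracting 1 keeps the integral absolutely convergent on the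
imaginary axis, and `-iu` is off the branch cut because `u ≠ 0`. -/
theorem integral_cpow_mul_exp_I_mul_sub_one_aux {z : ℂ} (hz : -1 < z.re) (hz' : z.re < 0)
    {u : ℝ} (hu : u ≠ 0) :
    ∫ t in Ioi (0 : ℝ), (t : ℂ) ^ (z - 1) * (Complex.exp (-(-(Complex.I * u)) * t) - 1) =
      (-(Complex.I * u)) ^ (-z) * Complex.Gamma z := by
  set a : ℝ → ℂ := fun ε => ε - Complex.I * u with ha
  have hare : ∀ ε, (a ε).re = ε := fun ε => by simp [ha]
  have ha0 : Tendsto a (𝓝[>] 0) (𝓝 (-(Complex.I * u))) := by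
    have : Continuous a := by fun_prop
    have h := this.tendsto 0
    simp only [ha, Complex.ofReal_zero, zero_sub] at h
    exact h.mono_left nhdsWithin_le_nhds
  have hslit : -(Complex.I * u) ∈ Complex.slitPlane := Or.inr (by simpa using hu)
  have h1 : Tendsto (fun ε => a ε ^ (-z) * Complex.Gamma z) (𝓝[>] 0)
      (𝓝 ((-(Complex.I * u)) ^ (-z) * Complex.Gamma z)) :=
    (((continuousAt_cpow_const hslit).tendsto.comp ha0).mul_const _)
  refine tendsto_nhds_unique ?_ h1
  have h2 : Tendsto (fun ε => ∫ t in Ioi (0 : ℝ), (t : ℂ) ^ (z - 1) *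
      (Complex.exp (-a ε * t) - 1)) (𝓝[>] 0) (𝓝 (∫ t in Ioi (0 : ℝ), (t : ℂ) ^ (z - 1) *
        (Complex.exp (-(-(Complex.I * u)) * t) - 1))) := by
    refine tendsto_integral_filter_of_dominated_convergence
      (fun t => (2 + |u|) * (t ^ (z.re - 1) * min 2 t))
      (Eventually.of_forall fun ε => aestronglyMeasurable_cpow_mul_exp_neg_mul_sub_one z _) ?_
      ((integrableOn_rpow_mul_min hz hz').const_mul _) ?_
    · filter_upwards [Ioc_mem_nhdsGT one_pos] with ε hε
      filter_upwards [ae_restrict_mem measurableSet_Ioi] with t ht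
      have ht0 : 0 < t := ht
      refine (norm_cpow_mul_exp_neg_mul_sub_one_le (by rw [hare]; exact hε.1.le) z ht).trans ?_
      have hn : ‖a ε‖ ≤ 1 + |u| := by
        refine (norm_sub_le _ _).trans ?_
        simpa [abs_of_pos hε.1] using hε.2
      have hmin : 0 ≤ min 2 t := le_min (by norm_num) ht0.le
      exact mul_le_mul_of_nonneg_right (by linarith) (by positivity)
    · refine Eventually.of_forall fun t => ?_
      have : Continuous fun b : ℂ => (t : ℂ) ^ (z - 1) * (Complex.exp (-b * t) - 1) := by fun_prop
      exact (this.tendsto _).comp ha0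
  refine h2.congr' ?_
  filter_upwards [self_mem_nhdsWithin] with ε hε
  exact integral_cpow_mul_exp_neg_mul_sub_one hz hz' (by rw [hare]; exact hε)

theorem ofReal_mul_cpow {x : ℝ} (hx : 0 < x) {w : ℂ} (hw : w ≠ 0) (r : ℂ) :
    ((x : ℂ) * w) ^ r = (x : ℂ) ^ r * w ^ r := by
  have hx0 : (x : ℂ) ≠ 0 := by exact_mod_cast hx.ne'
  rw [Complex.cpow_def_of_ne_zero (mul_ne_zero hx0 hw), Complex.log_ofReal_mul hx hw,
    Complex.cpow_def_of_ne_zero hx0, Complex.cpow_def_of_ne_zero hw, ← Complex.exp_add,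
    Complex.ofReal_log hx.le, add_mul]

/-- The Mellin transform of `t ↦ exp (i u t) - 1` in the strip `-1 < re z < 0`. -/
theorem mellin_exp_I_mul_sub_one {z : ℂ} (hz : -1 < z.re) (hz' : z.re < 0) (u : ℝ) :
    mellin (fun t : ℝ => Complex.exp (Complex.I * u * t) - 1) z =
      Complex.Gamma z * (Complex.cos (Real.pi * z / 2) * ((|u| : ℝ) : ℂ) ^ (-z) +
        Complex.I * Complex.sin (Real.pi * z / 2) *
          (((Real.sign u : ℝ) : ℂ) * ((|u| : ℝ) : ℂ) ^ (-z))) := by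
  have hz0 : z ≠ 0 := by rintro rfl; simp at hz'
  rcases eq_or_ne u 0 with rfl | hu
  -- For `u = 0` both sides vanish, since `0 ^ (-z) = 0`.
  · simp [mellin, Complex.zero_cpow (neg_ne_zero.2 hz0)]
  have hmain := integral_cpow_mul_exp_I_mul_sub_one_aux hz hz' hu
  simp only [neg_neg] at hmain
  rw [mellin]
  simp only [smul_eq_mul]
  rw [hmain]
  have hsq : ∀ w : ℂ, Complex.cos w + Complex.I * Complex.sin w = Complex.exp (Complex.I * w) := by
    intro w
    rw [mul_comm Complex.I w, Complex.exp_mul_I]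
    ring
  have hsq' : ∀ w : ℂ, Complex.cos w - Complex.I * Complex.sin w =
      Complex.exp (-(Complex.I * w)) := by
    intro w
    rw [← mul_neg, ← hsq, Complex.cos_neg, Complex.sin_neg]
    ring
  -- Here `-iu` is `|u|` times `i` or `-i`, and `(±i) ^ (-z) = e^{∓iπz/2}`; this is where the sign
  -- of `u` enters.
  rcases lt_or_gt_of_ne hu with hneg | hpos
  · have e : -(Complex.I * (u : ℂ)) = ((|u| : ℝ) : ℂ) * Complex.I := by
      rw [abs_of_neg hneg]
      push_cast
      ring
    have hI : Complex.I ^ (-z) = Complex.exp (-(Complex.I * (Real.pi * z / 2))) := by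
      rw [Complex.cpow_def_of_ne_zero Complex.I_ne_zero, Complex.log_I]
      congr 1
      ring
    rw [e, ofReal_mul_cpow (abs_pos.2 hu) Complex.I_ne_zero, hI, ← hsq', Real.sign_of_neg hneg]
    push_cast
    ring
  · have e : -(Complex.I * (u : ℂ)) = ((|u| : ℝ) : ℂ) * -Complex.I := by
      rw [abs_of_pos hpos]
      ring
    have hI : (-Complex.I) ^ (-z) = Complex.exp (Complex.I * (Real.pi * z / 2)) := by
      rw [Complex.cpow_def_of_ne_zero (neg_ne_zero.2 Complex.I_ne_zero), Complex.log_neg_I]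
      congr 1
      ring
    rw [e, ofReal_mul_cpow (abs_pos.2 hu) (neg_ne_zero.2 Complex.I_ne_zero), hI, ← hsq,
      Real.sign_of_pos hpos]
    push_cast
    ring

/-! ### The oscillatory integral of P and its expansion at 0 -/

theorem exists_norm_exp_I_mul_sub_sum_le (m : ℕ) : ∃ C : ℝ, ∀ v : ℝ,
    ‖Complex.exp (Complex.I * v) - ∑ j ∈ Finset.range m, (Complex.I * v) ^ j / (j.factorial : ℂ)‖ ≤
      C * |v| ^ m := by
  have hI : ∀ v : ℝ, ‖Complex.I * (v : ℂ)‖ = |v| := fun v => by simp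
  have hexp : ∀ v : ℝ, ‖Complex.exp (Complex.I * v)‖ = 1 := fun v => by
    rw [mul_comm, Complex.norm_exp_ofReal_mul_I]
  rcases Nat.eq_zero_or_pos m with rfl | hm
  · exact ⟨1, fun v => by simp [hexp]⟩
  -- The first summand is the Taylor bound for `|v| ≤ 1`. For `|v| ≥ 1` the exponential and each of
  -- the `m` terms are at most `|v| ^ m`, hence `1 + m`.
  refine ⟨(m.succ : ℝ) * (m.factorial * m : ℝ)⁻¹ + (1 + m), fun v => ?_⟩
  have h0 : 0 ≤ (m.succ : ℝ) * (m.factorial * m : ℝ)⁻¹ := by positivity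
  rcases le_total |v| 1 with hv | hv
  · refine (Complex.exp_bound (by rw [hI]; exact hv) hm).trans ?_
    rw [hI, mul_comm]
    have : 0 ≤ (1 + (m : ℝ)) * |v| ^ m := by positivity
    linarith
  · have hpow : 1 ≤ |v| ^ m := one_le_pow₀ hv
    have hsum : ‖∑ j ∈ Finset.range m, (Complex.I * v) ^ j / (j.factorial : ℂ)‖ ≤
        ∑ j ∈ Finset.range m, |v| ^ m := by
      refine norm_sum_le_of_le _ fun j hj => ?_
      rw [norm_div, norm_pow, hI, Complex.norm_natCast]
      have h1 : (1 : ℝ) ≤ j.factorial := by exact_mod_cast j.factorial_pos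
      exact (div_le_self (by positivity) h1).trans
        (pow_le_pow_right₀ hv (Finset.mem_range.1 hj).le)
    rw [Finset.sum_const, Finset.card_range, nsmul_eq_mul] at hsum
    refine (norm_sub_le _ _).trans ?_
    rw [hexp]
    have : 0 ≤ ((m.succ : ℝ) * (m.factorial * m : ℝ)⁻¹) * |v| ^ m := by positivity
    linarith

variable {p q : ℕ}

@[fun_prop]
theorem continuous_P : Continuous (P : V p q → ℝ) := by
  unfold P
  fun_prop

theorem abs_P_le (x : V p q) : |P x| ≤ ‖x‖ ^ 2 := by
  have h1 : 0 ≤ ∑ i : Fin p, x (Sum.inl i) ^ 2 := Finset.sum_nonneg fun _ _ => sq_nonneg _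
  have h2 : 0 ≤ ∑ j : Fin q, x (Sum.inr j) ^ 2 := Finset.sum_nonneg fun _ _ => sq_nonneg _
  rw [EuclideanSpace.real_norm_sq_eq, Fintype.sum_sum_type, P, abs_le]
  constructor <;> linarith

theorem integrable_norm_mul_abs_P_pow (f : 𝓢(V p q, ℂ)) (k : ℕ) :
    Integrable fun x => ‖f x‖ * |P x| ^ k := by
  refine (f.integrable_pow_mul volume (2 * k)).mono'
    (Continuous.aestronglyMeasurable (by fun_prop)) (Eventually.of_forall fun x => ?_)
  rw [norm_mul, norm_norm, norm_pow, Real.norm_eq_abs, abs_abs, mul_comm, pow_mul]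
  gcongr
  exact abs_P_le x

/-- The oscillatory integral `∫ f(x) exp(i r P(x)) dx`. -/
noncomputable def oscIntegral (f : 𝓢(V p q, ℂ)) (r : ℝ) : ℂ :=
  ∫ x, f x * Complex.exp (Complex.I * ((r * P x : ℝ) : ℂ))

theorem norm_exp_I_mul_ofReal (v : ℝ) : ‖Complex.exp (Complex.I * (v : ℂ))‖ = 1 := by
  rw [mul_comm, Complex.norm_exp_ofReal_mul_I]

theorem integrable_mul_exp_I (f : 𝓢(V p q, ℂ)) (r : ℝ) :
    Integrable fun x => f x * Complex.exp (Complex.I * ((r * P x : ℝ) : ℂ)) := by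
  refine f.integrable.norm.mono' (Continuous.aestronglyMeasurable (by fun_prop))
    (Eventually.of_forall fun x => ?_)
  rw [norm_mul, norm_exp_I_mul_ofReal, mul_one]

@[fun_prop]
theorem continuous_oscIntegral (f : 𝓢(V p q, ℂ)) : Continuous (oscIntegral f) := by
  refine continuous_of_dominated (bound := fun x => ‖f x‖)
    (fun r => (integrable_mul_exp_I f r).aestronglyMeasurable)
    (fun r => Eventually.of_forall fun x => ?_) f.integrable.norm
    (Eventually.of_forall fun x => by fun_prop)
  rw [norm_mul, norm_exp_I_mul_ofReal, mul_one]

/-- The coefficients of the Taylor expansion at `0` of `t ↦ oscIntegral f (r * t)`. -/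
noncomputable def oscCoeff (f : 𝓢(V p q, ℂ)) (r : ℝ) (j : ℕ) : ℂ :=
  ∫ x, f x * ((Complex.I * ((r * P x : ℝ) : ℂ)) ^ j / (j.factorial : ℂ))

theorem oscCoeff_zero (f : 𝓢(V p q, ℂ)) (r : ℝ) : oscCoeff f r 0 = ∫ x, f x := by
  simp [oscCoeff]

theorem integrable_mul_P_pow (f : 𝓢(V p q, ℂ)) (r : ℝ) (j : ℕ) :
    Integrable fun x => f x * ((Complex.I * ((r * P x : ℝ) : ℂ)) ^ j / (j.factorial : ℂ)) := by
  refine ((integrable_norm_mul_abs_P_pow f j).const_mul (|r| ^ j / j.factorial)).mono'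
    (Continuous.aestronglyMeasurable (by fun_prop)) (Eventually.of_forall fun x => le_of_eq ?_)
  simp only [norm_mul, norm_div, norm_pow, Complex.norm_I, Complex.norm_real, Real.norm_eq_abs,
    one_mul, Complex.norm_natCast]
  ring

/-- The Taylor bound for `e^{iv}` is global in `v`, so it can be integrated against `f`, all of
whose moments in `|P|` are finite. -/
theorem hasExpansion_oscIntegral (f : 𝓢(V p q, ℂ)) (r : ℝ) :
    HasExpansion (fun t => oscIntegral f (r * t)) (oscCoeff f r) where
  continuous := by fun_prop
  bound m := by
    obtain ⟨C, hC⟩ := exists_norm_exp_I_mul_sub_sum_le m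
    refine ⟨∫ x, C * |r| ^ m * (‖f x‖ * |P x| ^ m), fun t ht => ?_⟩
    have hsum : ∑ j ∈ Finset.range m, oscCoeff f r j * (t : ℂ) ^ j = ∫ x, f x *
        ∑ j ∈ Finset.range m, (Complex.I * ((r * t * P x : ℝ) : ℂ)) ^ j / (j.factorial : ℂ) := by
      simp only [Finset.mul_sum]
      rw [integral_finsetSum _ fun j _ => integrable_mul_P_pow f (r * t) j]
      refine Finset.sum_congr rfl fun j _ => ?_
      rw [oscCoeff, ← integral_mul_const]
      congr 1
      funext x
      push_cast
      ring
    have hint : Integrable fun x => f x * ∑ j ∈ Finset.range m,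
        (Complex.I * ((r * t * P x : ℝ) : ℂ)) ^ j / (j.factorial : ℂ) := by
      simp only [Finset.mul_sum]
      exact integrable_finsetSum _ fun j _ => integrable_mul_P_pow f (r * t) j
    rw [hsum, oscIntegral, ← integral_sub (integrable_mul_exp_I f _) hint, ← integral_mul_const]
    refine norm_integral_le_of_norm_le
      (((integrable_norm_mul_abs_P_pow f m).const_mul _).mul_const _)
      (Eventually.of_forall fun x => ?_)
    rw [← mul_sub, norm_mul]
    refine (mul_le_mul_of_nonneg_left (hC (r * t * P x)) (norm_nonneg _)).trans_eq ?_
    rw [abs_mul, abs_mul, abs_of_pos ht.1]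
    ring

/-! ### Gaussians and the inversion formula for the oscillatory integral -/

section Gaussian

variable {ι : Type*} [Fintype ι]

theorem integrable_gaussian_euclidean {b : ι → ℂ} (hb : ∀ i, 0 < (b i).re) (c : ι → ℂ) :
    Integrable fun v : EuclideanSpace ℝ ι =>
      Complex.exp (-∑ i, b i * (v i : ℂ) ^ 2 + ∑ i, c i * v i) := by
  rw [← (PiLp.volume_preserving_toLp ι).integrable_comp_emb
    (MeasurableEquiv.toLp 2 _).measurableEmbedding]
  exact GaussianFourier.integrable_cexp_neg_sum_mul_add hb c

theorem integral_gaussian_euclidean {b : ι → ℂ} (hb : ∀ i, 0 < (b i).re) (c : ι → ℂ) :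
    ∫ v : EuclideanSpace ℝ ι, Complex.exp (-∑ i, b i * (v i : ℂ) ^ 2 + ∑ i, c i * v i) =
      ∏ i, (Real.pi / b i) ^ (1 / 2 : ℂ) * Complex.exp (c i ^ 2 / (4 * b i)) := by
  rw [← (PiLp.volume_preserving_toLp ι).integral_comp
    (MeasurableEquiv.toLp 2 _).measurableEmbedding]
  exact GaussianFourier.integral_cexp_neg_sum_mul_add hb c

end Gaussian

/-- Fubini moves the Fourier transform onto the Gaussian. The coefficients are complex so that they
can later approach the imaginary axis. -/
theorem integral_fhat_mul_gaussian (f : 𝓢(V p q, ℂ)) {b : Fin p ⊕ Fin q → ℂ}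
    (hb : ∀ i, 0 < (b i).re) :
    ∫ x, fhat f x * Complex.exp (-∑ i, b i * (x i : ℂ) ^ 2) =
      (∏ i, (Real.pi / b i) ^ (1 / 2 : ℂ)) *
        ∫ y, f y * Complex.exp (-∑ i, (y i : ℂ) ^ 2 / (4 * b i)) := by
  have hG := integrable_gaussian_euclidean hb 0
  simp only [Pi.zero_apply, zero_mul, Finset.sum_const_zero, add_zero] at hG
  set G : V p q → ℂ := fun x => Complex.exp (-∑ i, b i * (x i : ℂ) ^ 2) with hGdef
  have hGc : Continuous G := by fun_prop
  have hprod : Integrable (Function.uncurry fun (x y : V p q) =>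
      Complex.exp (Complex.I * ((⟪x, y⟫ : ℝ) : ℂ)) * f y * G x) (volume.prod volume) := by
    refine (hG.mul_prod f.integrable).mono (Continuous.aestronglyMeasurable (by fun_prop))
      (Eventually.of_forall fun z => le_of_eq ?_)
    simp only [Function.uncurry, norm_mul, norm_exp_I_mul_ofReal]
    ring
  have h1 : ∫ x, fhat f x * G x =
      ∫ x, ∫ y, Complex.exp (Complex.I * ((⟪x, y⟫ : ℝ) : ℂ)) * f y * G x := by
    congr 1
    funext x
    rw [fhat_apply, integral_mul_const]
  rw [h1, integral_integral_swap hprod, ← integral_const_mul]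
  congr 1
  funext y
  have h2 := integral_gaussian_euclidean hb fun i => Complex.I * (y i : ℂ)
  rw [Finset.prod_mul_distrib, ← Complex.exp_sum] at h2
  have h3 : ∑ i, (Complex.I * (y i : ℂ)) ^ 2 / (4 * b i) = -∑ i, (y i : ℂ) ^ 2 / (4 * b i) := by
    rw [← Finset.sum_neg_distrib]
    refine Finset.sum_congr rfl fun i _ => ?_
    rw [mul_pow, Complex.I_sq]
    ring
  rw [h3] at h2
  calc _ = ∫ x : V p q, f y * Complex.exp (-∑ i, b i * (x i : ℂ) ^ 2 +
        ∑ i, Complex.I * (y i : ℂ) * x i) := by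
        congr 1
        funext x
        have h4 : Complex.I * ((⟪x, y⟫ : ℝ) : ℂ) = ∑ i, Complex.I * (y i : ℂ) * x i := by
          rw [PiLp.inner_apply, Complex.ofReal_sum, Finset.mul_sum]
          refine Finset.sum_congr rfl fun i _ => ?_
          simp [mul_assoc]
        rw [Complex.exp_add, ← h4, hGdef]
        ring
    _ = _ := by
        rw [integral_const_mul, h2]
        ring

/-- The quadratic weight `ε |x|² - i r P(x)` has these diagonal coefficients. -/
noncomputable def quadCoeff (p q : ℕ) (r ε : ℝ) : Fin p ⊕ Fin q → ℂ :=
  Sum.elim (fun _ => ε - Complex.I * r) fun _ => ε + Complex.I * r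

theorem continuous_quadCoeff (r : ℝ) (i : Fin p ⊕ Fin q) :
    Continuous fun ε => quadCoeff p q r ε i := by
  cases i <;> simp only [quadCoeff, Sum.elim_inl, Sum.elim_inr] <;> fun_prop

theorem re_quadCoeff (r ε : ℝ) (i : Fin p ⊕ Fin q) : (quadCoeff p q r ε i).re = ε := by
  cases i <;> simp [quadCoeff]

theorem quadCoeff_zero_mem_slitPlane {r : ℝ} (hr : r ≠ 0) (i : Fin p ⊕ Fin q) :
    Real.pi / quadCoeff p q r 0 i ∈ Complex.slitPlane := by
  have hpi := Real.pi_pos.ne'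
  cases i <;> refine Or.inr ?_ <;> simp [quadCoeff, hr, hpi, Complex.div_im, Complex.normSq]

/-- Limit `ε → 0⁺` of the Gaussian identity with `b = quadCoeff p q r ε`. Both integrands are
dominated by the Schwartz function, as `b` and `1 / b` have nonnegative real part, and the square
roots are continuous because `π / b` stays off the cut. -/
theorem oscIntegral_fhat_aux (f : 𝓢(V p q, ℂ)) {r : ℝ} (hr : r ≠ 0) :
    oscIntegral (fhat f) r =
      (∏ i, (Real.pi / quadCoeff p q r 0 i) ^ (1 / 2 : ℂ)) * oscIntegral f (-(4 * r)⁻¹) := by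
  have hne : ∀ i, quadCoeff p q r 0 i ≠ 0 := fun i h => by
    have := quadCoeff_zero_mem_slitPlane hr i
    rw [h, div_zero] at this
    exact Complex.zero_notMem_slitPlane this
  have hb0 : ∀ i, Tendsto (fun ε => quadCoeff p q r ε i) (𝓝[>] 0) (𝓝 (quadCoeff p q r 0 i)) :=
    fun i => ((continuous_quadCoeff r i).tendsto 0).mono_left nhdsWithin_le_nhds
  have hlim1 : Tendsto (fun ε => ∫ x, fhat f x *
      Complex.exp (-∑ i, quadCoeff p q r ε i * (x i : ℂ) ^ 2)) (𝓝[>] 0)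
      (𝓝 (oscIntegral (fhat f) r)) := by
    refine tendsto_integral_filter_of_dominated_convergence (fun x => ‖fhat f x‖)
      (Eventually.of_forall fun ε => Continuous.aestronglyMeasurable (by fun_prop)) ?_
      (fhat f).integrable.norm (Eventually.of_forall fun x => ?_)
    · filter_upwards [self_mem_nhdsWithin] with ε hε
      refine Eventually.of_forall fun x => ?_
      rw [norm_mul, Complex.norm_exp]
      refine mul_le_of_le_one_right (norm_nonneg _) (Real.exp_le_one_iff.2 ?_)
      rw [Complex.neg_re, Complex.re_sum, neg_nonpos]
      refine Finset.sum_nonneg fun i _ => ?_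
      rw [← Complex.ofReal_pow, Complex.re_mul_ofReal, re_quadCoeff]
      exact mul_nonneg (le_of_lt hε) (sq_nonneg _)
    · have e : Complex.I * ((r * P x : ℝ) : ℂ) = -∑ i, quadCoeff p q r 0 i * (x i : ℂ) ^ 2 := by
        simp only [Fintype.sum_sum_type, quadCoeff, Sum.elim_inl, Sum.elim_inr, ← Finset.mul_sum, P]
        push_cast
        ring
      rw [e]
      exact ((Complex.continuous_exp.tendsto _).comp
        (tendsto_finsetSum _ fun i _ => (hb0 i).mul_const _).neg).const_mul _
  have hlim2 : Tendsto (fun ε => ∫ y, f y *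
      Complex.exp (-∑ i, (y i : ℂ) ^ 2 / (4 * quadCoeff p q r ε i))) (𝓝[>] 0)
      (𝓝 (oscIntegral f (-(4 * r)⁻¹))) := by
    refine tendsto_integral_filter_of_dominated_convergence (fun x => ‖f x‖)
      (Eventually.of_forall fun ε => Continuous.aestronglyMeasurable (by fun_prop)) ?_
      f.integrable.norm (Eventually.of_forall fun x => ?_)
    · filter_upwards [self_mem_nhdsWithin] with ε hε
      refine Eventually.of_forall fun x => ?_
      rw [norm_mul, Complex.norm_exp]
      refine mul_le_of_le_one_right (norm_nonneg _) (Real.exp_le_one_iff.2 ?_)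
      rw [Complex.neg_re, Complex.re_sum, neg_nonpos]
      refine Finset.sum_nonneg fun i _ => ?_
      rw [← Complex.ofReal_pow, div_eq_mul_inv, Complex.re_ofReal_mul, Complex.inv_re]
      refine mul_nonneg (sq_nonneg _) (div_nonneg ?_ (Complex.normSq_nonneg _))
      have : (4 * quadCoeff p q r ε i).re = 4 * ε := by
        simp [re_quadCoeff]
      rw [this]
      exact mul_nonneg (by norm_num) (le_of_lt hε)
    · have e : Complex.I * ((-(4 * r)⁻¹ * P x : ℝ) : ℂ) =
          -∑ i, (x i : ℂ) ^ 2 / (4 * quadCoeff p q r 0 i) := by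
        have hr' : (r : ℂ) ≠ 0 := by exact_mod_cast hr
        simp only [Fintype.sum_sum_type, quadCoeff, Sum.elim_inl, Sum.elim_inr, ← Finset.sum_div, P]
        push_cast
        rw [zero_sub, zero_add]
        field_simp
        rw [Complex.I_sq]
        ring
      rw [e]
      exact ((Complex.continuous_exp.tendsto _).comp
        (tendsto_finsetSum _ fun i _ => (tendsto_const_nhds.div ((hb0 i).const_mul 4)
          (mul_ne_zero (by norm_num) (hne i)))).neg).const_mul _
  have hlim3 : Tendsto (fun ε => ∏ i, (Real.pi / quadCoeff p q r ε i) ^ (1 / 2 : ℂ)) (𝓝[>] 0)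
      (𝓝 (∏ i, (Real.pi / quadCoeff p q r 0 i) ^ (1 / 2 : ℂ))) :=
    tendsto_finsetProd _ fun i _ =>
      (continuousAt_cpow_const (quadCoeff_zero_mem_slitPlane hr i)).tendsto.comp
        (tendsto_const_nhds.div (hb0 i) (hne i))
  refine tendsto_nhds_unique hlim1 ((hlim3.mul hlim2).congr' ?_)
  filter_upwards [self_mem_nhdsWithin] with ε hε
  exact (integral_fhat_mul_gaussian f fun i => by rw [re_quadCoeff]; exact hε).symm

/-! ### The Mellin transform of the oscillatory integral and its functional equation -/

theorem HasExpansion.coeff_eq {φ ψ : ℝ → ℂ} {c d : ℕ → ℂ} (h : HasExpansion φ c)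
    (h' : HasExpansion ψ d) {a : ℂ} (hφψ : ∀ t ∈ Ioc (0 : ℝ) 1, φ t = a * ψ t) (m : ℕ) :
    c m = a * d m := by
  induction m using Nat.strong_induction_on with
  | _ m ih =>
    obtain ⟨C, hC⟩ := h.bound (m + 1)
    obtain ⟨D, hD⟩ := h'.bound (m + 1)
    have key : ∀ t ∈ Ioc (0 : ℝ) 1, ‖c m - a * d m‖ ≤ (C + ‖a‖ * D) * t := by
      intro t ht
      have hsum : ∑ j ∈ Finset.range m, c j * (t : ℂ) ^ j =
          a * ∑ j ∈ Finset.range m, d j * (t : ℂ) ^ j := by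
        rw [Finset.mul_sum]
        refine Finset.sum_congr rfl fun j hj => ?_
        rw [ih j (Finset.mem_range.1 hj), mul_assoc]
      have e : (c m - a * d m) * (t : ℂ) ^ m =
          a * (ψ t - ∑ j ∈ Finset.range (m + 1), d j * (t : ℂ) ^ j) -
            (φ t - ∑ j ∈ Finset.range (m + 1), c j * (t : ℂ) ^ j) := by
        rw [Finset.sum_range_succ, Finset.sum_range_succ, hsum, hφψ t ht]
        ring
      have h1 : ‖c m - a * d m‖ * t ^ m ≤ (C + ‖a‖ * D) * t * t ^ m := by
        have h2 := norm_sub_le (a * (ψ t - ∑ j ∈ Finset.range (m + 1), d j * (t : ℂ) ^ j))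
          (φ t - ∑ j ∈ Finset.range (m + 1), c j * (t : ℂ) ^ j)
        rw [← e, norm_mul, norm_mul, norm_pow, Complex.norm_of_nonneg ht.1.le] at h2
        have h3 := mul_le_mul_of_nonneg_left (hD t ht) (norm_nonneg a)
        have h4 := hC t ht
        calc _ ≤ _ := h2.trans (add_le_add h3 h4)
          _ = _ := by ring
      exact le_of_mul_le_mul_right h1 (pow_pos ht.1 m)
    have hlim : Tendsto (fun t : ℝ => (C + ‖a‖ * D) * t) (𝓝[>] 0) (𝓝 0) := by
      have : Continuous fun t : ℝ => (C + ‖a‖ * D) * t := by fun_prop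
      have h1 := this.tendsto 0
      rw [mul_zero] at h1
      exact h1.mono_left nhdsWithin_le_nhds
    have h0 : ‖c m - a * d m‖ ≤ 0 := by
      refine ge_of_tendsto hlim ?_
      filter_upwards [Ioc_mem_nhdsGT one_pos] with t ht
      exact key t ht
    exact sub_eq_zero.1 (norm_le_zero_iff.1 h0)

/-- `mellinCut` depends on the coefficients as well as on the function; uniqueness of asymptotic
expansions makes them proportional too. -/
theorem HasExpansion.mellinCut_const_mul {φ ψ : ℝ → ℂ} {c d : ℕ → ℂ} (h : HasExpansion φ c)
    (h' : HasExpansion ψ d) {a : ℂ} (hφψ : ∀ t ∈ Ioc (0 : ℝ) 1, φ t = a * ψ t) (s : ℂ) :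
    mellinCut φ c s = a * mellinCut ψ d s := by
  have hcd := h.coeff_eq h' hφψ
  have hrem : ∀ m, cutRemainder φ c m = fun t => a • cutRemainder ψ d m t := by
    intro m
    funext t
    by_cases ht : t ∈ Ioc (0 : ℝ) 1
    · simp only [cutRemainder, indicator_of_mem ht, hcd, hφψ t ht, smul_eq_mul, mul_sub,
        Finset.mul_sum, mul_assoc]
    · simp only [cutRemainder, indicator_of_notMem ht, smul_zero]
  rw [mellinCut, mellinCut, mellinCutStep, mellinCutStep, hrem, mellin_const_smul, smul_eq_mul,
    mul_add, Finset.mul_sum]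
  simp only [hcd, mul_div_assoc]

/-- The constant `(2π)^(n/2) exp(i σ (p - q) π / 4)`. -/
noncomputable def oscConst (p q : ℕ) (σ : ℝ) : ℂ :=
  ((2 * Real.pi : ℝ) : ℂ) ^ (((p : ℂ) + q) / 2) *
    Complex.exp (Complex.I * (σ * (((p : ℂ) - q) * Real.pi / 4)))

theorem oscConst_ne_zero (p q : ℕ) (σ : ℝ) : oscConst p q σ ≠ 0 := by
  refine mul_ne_zero ?_ (Complex.exp_ne_zero _)
  have h : ((2 * Real.pi : ℝ) : ℂ) ≠ 0 := by exact_mod_cast Real.two_pi_pos.ne'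
  rw [Complex.cpow_def_of_ne_zero h]
  exact Complex.exp_ne_zero _

theorem ofReal_mul_I_cpow_half {x : ℝ} (hx : 0 < x) {σ : ℝ} (hσ : σ = 1 ∨ σ = -1) :
    ((x : ℂ) * (σ * Complex.I)) ^ (1 / 2 : ℂ) =
      (x : ℂ) ^ (1 / 2 : ℂ) * Complex.exp (Complex.I * (σ * (Real.pi / 4))) := by
  rcases hσ with rfl | rfl
  · rw [ofReal_mul_cpow hx (by simp), Complex.ofReal_one, one_mul,
      Complex.cpow_def_of_ne_zero Complex.I_ne_zero, Complex.log_I]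
    congr 2
    ring
  · rw [ofReal_mul_cpow hx (by simp), Complex.ofReal_neg, Complex.ofReal_one, neg_one_mul,
      Complex.cpow_def_of_ne_zero (neg_ne_zero.2 Complex.I_ne_zero), Complex.log_neg_I]
    congr 2
    ring

/-- Each factor `π / b_i` is `2π / t` times `±i`, so its principal root has phase `e^{±iπ/4}`; the
`p` and `q` factors carry opposite signs. -/
theorem prod_quadCoeff {σ : ℝ} (hσ : σ = 1 ∨ σ = -1) {t : ℝ} (ht : 0 < t) :
    ∏ i, (Real.pi / quadCoeff p q (σ / 2 * t) 0 i) ^ (1 / 2 : ℂ) =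
      oscConst p q σ * (t : ℂ) ^ (-(((p : ℂ) + q) / 2)) := by
  have hσ2 : (σ : ℂ) * σ = 1 := by rcases hσ with rfl | rfl <;> simp
  have hσ0 : (σ : ℂ) ≠ 0 := left_ne_zero_of_mul_eq_one hσ2
  have ht0 : (t : ℂ) ≠ 0 := by exact_mod_cast ht.ne'
  have hσ' : -σ = 1 ∨ -σ = -1 := by rcases hσ with rfl | rfl <;> simp
  have hx : 0 < 2 * Real.pi / t := by positivity
  have h1 : (Real.pi : ℂ) / (((0 : ℝ) : ℂ) - Complex.I * ((σ / 2 * t : ℝ) : ℂ)) =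
      ((2 * Real.pi / t : ℝ) : ℂ) * (σ * Complex.I) := by
    push_cast
    have hI := Complex.I_ne_zero
    rw [zero_sub]
    field_simp
    linear_combination -Complex.I ^ 2 * hσ2 - Complex.I_sq
  have h2 : (Real.pi : ℂ) / (((0 : ℝ) : ℂ) + Complex.I * ((σ / 2 * t : ℝ) : ℂ)) =
      ((2 * Real.pi / t : ℝ) : ℂ) * ((-σ : ℝ) * Complex.I) := by
    push_cast
    have hI := Complex.I_ne_zero
    rw [zero_add]
    field_simp
    linear_combination Complex.I ^ 2 * hσ2 + Complex.I_sq
  have hpow : (((2 * Real.pi / t : ℝ) : ℂ) ^ (1 / 2 : ℂ)) ^ (p + q) =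
      ((2 * Real.pi : ℝ) : ℂ) ^ (((p : ℂ) + q) / 2) * (t : ℂ) ^ (-(((p : ℂ) + q) / 2)) := by
    rw [← Complex.cpow_nat_mul, div_eq_mul_inv, Complex.ofReal_mul,
      Complex.mul_cpow_ofReal_nonneg Real.two_pi_pos.le (inv_pos.2 ht).le, Complex.ofReal_inv,
      Complex.inv_cpow _ _ (by
        simp [Complex.arg_ofReal_of_nonneg ht.le, Real.pi_pos.ne]), Complex.cpow_neg]
    have : ((p + q : ℕ) : ℂ) * (1 / 2) = ((p : ℂ) + q) / 2 := by push_cast; ring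
    rw [this]
  simp only [Fintype.prod_sum_type, quadCoeff, Sum.elim_inl, Sum.elim_inr, Finset.prod_const,
    Finset.card_univ, Fintype.card_fin]
  rw [h1, h2, ofReal_mul_I_cpow_half hx hσ, ofReal_mul_I_cpow_half hx hσ', mul_pow, mul_pow,
    ← Complex.exp_nat_mul, ← Complex.exp_nat_mul]
  have hexp : Complex.exp (Complex.I * (σ * (((p : ℂ) - q) * Real.pi / 4))) =
      Complex.exp ((p : ℂ) * (Complex.I * (σ * (Real.pi / 4)))) *
        Complex.exp ((q : ℂ) * (Complex.I * ((-σ : ℝ) * (Real.pi / 4)))) := by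
    rw [← Complex.exp_add]
    congr 1
    push_cast
    ring
  rw [oscConst, hexp]
  rw [pow_add] at hpow
  linear_combination Complex.exp ((p : ℂ) * (Complex.I * (σ * (Real.pi / 4)))) *
        Complex.exp ((q : ℂ) * (Complex.I * ((-σ : ℝ) * (Real.pi / 4)))) * hpow

theorem oscIntegral_fhat (f : 𝓢(V p q, ℂ)) {σ : ℝ} (hσ : σ = 1 ∨ σ = -1) {t : ℝ} (ht : 0 < t) :
    oscIntegral (fhat f) (σ / 2 * t) = oscConst p q σ *
      ((t : ℂ) ^ (-(((p : ℂ) + q) / 2)) * oscIntegral f (-σ / 2 * t⁻¹)) := by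
  have hσ0 : σ ≠ 0 := by rcases hσ with rfl | rfl <;> norm_num
  rw [oscIntegral_fhat_aux f (mul_ne_zero (div_ne_zero hσ0 two_ne_zero) ht.ne'),
    prod_quadCoeff hσ ht, mul_assoc]
  congr 3
  rcases hσ with rfl | rfl <;> field_simp <;> norm_num

/-- The inversion formula for `-σ` at `t⁻¹`, solved for `f`; it converts the tail `t > 1` into an
integral of `fhat f` over `(0, 1]`. -/
theorem oscIntegral_eq_fhat (f : 𝓢(V p q, ℂ)) {σ : ℝ} (hσ : σ = 1 ∨ σ = -1) {t : ℝ} (ht : 0 < t) :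
    oscIntegral f (σ / 2 * t) = (oscConst p q (-σ))⁻¹ *
      ((t : ℂ) ^ (-(((p : ℂ) + q) / 2)) * oscIntegral (fhat f) (-σ / 2 * t⁻¹)) := by
  have hσ' : -σ = 1 ∨ -σ = -1 := by rcases hσ with rfl | rfl <;> simp
  have hc := oscConst_ne_zero p q (-σ)
  have ht0 : (t : ℂ) ≠ 0 := by exact_mod_cast ht.ne'
  rw [oscIntegral_fhat f hσ' (inv_pos.2 ht), inv_inv, neg_neg, Complex.ofReal_inv,
    Complex.inv_cpow _ _ (by simp [Complex.arg_ofReal_of_nonneg ht.le, Real.pi_pos.ne]),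
    Complex.cpow_neg]
  have := (Complex.cpow_ne_zero_iff (x := (t : ℂ)) (y := ((p : ℂ) + q) / 2)).2 (Or.inl ht0)
  field_simp

/-- The meromorphic continuation of the Mellin transform of `t ↦ oscIntegral f (σ / 2 * t)`. -/
noncomputable def oscMellin (f : 𝓢(V p q, ℂ)) (σ : ℝ) (z : ℂ) : ℂ :=
  mellinCut (fun t => oscIntegral f (σ / 2 * t)) (oscCoeff f (σ / 2)) z +
    (oscConst p q (-σ))⁻¹ * mellinCut (fun t => oscIntegral (fhat f) (-σ / 2 * t))
      (oscCoeff (fhat f) (-σ / 2)) (((p : ℂ) + q) / 2 - z)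

theorem meromorphicAt_oscMellin (f : 𝓢(V p q, ℂ)) (σ : ℝ) (z : ℂ) :
    MeromorphicAt (oscMellin f σ) z := by
  refine ((hasExpansion_oscIntegral f _).meromorphicAt_mellinCut z).add
    ((MeromorphicAt.const _ z).mul ?_)
  exact MeromorphicAt.comp_analyticAt
    ((hasExpansion_oscIntegral (fhat f) _).meromorphicAt_mellinCut _)
    (g := fun z => ((p : ℂ) + q) / 2 - z) (by fun_prop)

/-- The functional equation of `oscMellin`. -/
theorem oscMellin_fhat (f : 𝓢(V p q, ℂ)) {σ : ℝ} (hσ : σ = 1 ∨ σ = -1) (z : ℂ) :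
    oscMellin (fhat f) σ z = oscConst p q σ * oscMellin f (-σ) (((p : ℂ) + q) / 2 - z) := by
  have hσ' : -σ = 1 ∨ -σ = -1 := by rcases hσ with rfl | rfl <;> simp
  -- The second half of `oscMellin (fhat f)` involves `fhat (fhat f)`. Two applications of the
  -- inversion formula make its oscillatory integral a multiple of that of `f`, without Fourier
  -- inversion; the two halves then change places.
  have key := (hasExpansion_oscIntegral (fhat (fhat f)) (-σ / 2)).mellinCut_const_mul
    (hasExpansion_oscIntegral f (-σ / 2)) (a := oscConst p q (-σ) * oscConst p q σ) (by
      intro t ht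
      have ht0 : (t : ℂ) ≠ 0 := by exact_mod_cast ht.1.ne'
      have hc := oscConst_ne_zero p q σ
      have hc' := oscConst_ne_zero p q (-σ)
      have h1 := oscIntegral_fhat (fhat f) hσ' ht.1
      have h2 := oscIntegral_eq_fhat f hσ' ht.1
      rw [neg_neg] at h1 h2
      simp only [h1, h2]
      field_simp) (((p : ℂ) + q) / 2 - z)
  rw [oscMellin, oscMellin, key, neg_neg, sub_sub_cancel]
  have hc := oscConst_ne_zero p q σ
  have hc' := oscConst_ne_zero p q (-σ)
  field_simp
  ring

theorem oscMellin_eq_mellin (hn : 0 < p + q) (f : 𝓢(V p q, ℂ)) {σ : ℝ} (hσ : σ = 1 ∨ σ = -1)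
    {z : ℂ} (hz : -1 < z.re) (hz' : z.re < 0) :
    oscMellin f σ z = mellin (fun t => oscIntegral f (σ / 2 * t) - ∫ x, f x) z := by
  have hk : (0 : ℝ) < ((p + q : ℕ) : ℝ) / 2 := by
    have : (0 : ℝ) < ((p + q : ℕ) : ℝ) := by exact_mod_cast hn
    positivity
  have hkc : ((((p + q : ℕ) : ℝ) / 2 : ℝ) : ℂ) = ((p : ℂ) + q) / 2 := by push_cast; ring
  have := (hasExpansion_oscIntegral f (σ / 2)).mellin_sub_const
    (hasExpansion_oscIntegral (fhat f) (-σ / 2)) hk (r := (oscConst p q (-σ))⁻¹)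
    (fun t ht => by rw [hkc]; exact oscIntegral_eq_fhat f hσ ht) hz hz'
  rw [hkc, oscCoeff_zero] at this
  exact this.symm

/-- In the strip `-1 < re z < 0` the Mellin transform of the oscillatory integral is a combination
of the two zeta integrals. -/
theorem oscMellin_eq_zetaIntegral (hn : 0 < p + q) (f : 𝓢(V p q, ℂ)) {σ : ℝ}
    (hσ : σ = 1 ∨ σ = -1) {z : ℂ} (hz : -1 < z.re) (hz' : z.re < 0)
    (hint : ∀ ε, Integrable fun x => f x * detPow ε (-z) x) :
    oscMellin f σ z = Complex.Gamma z * (2 : ℂ) ^ z *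
      (Complex.cos (Real.pi * z / 2) * zetaIntegral Parity.plus f (-z) +
        Complex.I * σ * Complex.sin (Real.pi * z / 2) * zetaIntegral Parity.minus f (-z)) := by
  have hσabs : |σ| = 1 := by rcases hσ with rfl | rfl <;> simp
  rw [oscMellin_eq_mellin hn f hσ hz hz', mellin]
  set F : ℝ → V p q → ℂ := fun t x => f x * ((t : ℂ) ^ (z - 1) *
    (Complex.exp (-(-(Complex.I * ((σ / 2 * P x : ℝ) : ℂ))) * t) - 1)) with hF
  have hmin := integrableOn_rpow_mul_min hz hz'
  have hFint : Integrable (Function.uncurry F) ((volume.restrict (Ioi 0)).prod volume) := by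
    -- The majorant is `t ^ (re z - 1) * min 2 t` times `‖f‖ (1 + |P|)`; the factor `1 + |P|` comes
    -- from the bound `1 + ‖a‖` with `a` imaginary.
    have hdom := hmin.integrable.mul_prod
      (((integrable_norm_mul_abs_P_pow f 0).add (integrable_norm_mul_abs_P_pow f 1)))
    refine hdom.mono' ?_ ?_
    · have h1 : Measurable fun w : ℝ × V p q => ((w.1 : ℂ)) ^ (z - 1) :=
        (Complex.measurable_ofReal.comp measurable_fst).pow_const _
      have h2 : Continuous fun w : ℝ × V p q =>
          Complex.exp (-(-(Complex.I * ((σ / 2 * P w.2 : ℝ) : ℂ))) * (w.1 : ℂ)) - 1 := by fun_prop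
      have h3 : Continuous fun w : ℝ × V p q => f w.2 := by fun_prop
      exact (h3.measurable.mul (h1.mul h2.measurable)).aestronglyMeasurable
    · have hmem : ∀ᵐ w : ℝ × V p q ∂((volume.restrict (Ioi 0)).prod volume), w.1 ∈ Ioi (0 : ℝ) :=
        Measure.quasiMeasurePreserving_fst.ae (ae_restrict_mem measurableSet_Ioi)
      filter_upwards [hmem] with w hw
      have hw0 : 0 < w.1 := hw
      simp only [Function.uncurry, hF, norm_mul, Pi.add_apply, pow_zero, mul_one, pow_one]
      have hb := norm_cpow_mul_exp_neg_mul_sub_one_le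
        (a := -(Complex.I * ((σ / 2 * P w.2 : ℝ) : ℂ))) (by simp) z hw0
      rw [norm_mul, norm_neg, norm_mul, Complex.norm_I, Complex.norm_real, one_mul, norm_mul,
        norm_div, Real.norm_eq_abs, Real.norm_eq_abs, Real.norm_eq_abs, hσabs, abs_two] at hb
      have hmn : 0 ≤ w.1 ^ (z.re - 1) * min 2 w.1 :=
        mul_nonneg (Real.rpow_nonneg hw0.le _) (le_min (by norm_num) hw0.le)
      have hP : 1 + 1 / 2 * |P w.2| ≤ 1 + |P w.2| := by linarith [abs_nonneg (P w.2)]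
      calc _ ≤ ‖f w.2‖ * ((1 + |P w.2|) * (w.1 ^ (z.re - 1) * min 2 w.1)) :=
            mul_le_mul_of_nonneg_left (hb.trans (mul_le_mul_of_nonneg_right hP hmn)) (norm_nonneg _)
        _ = _ := by ring
  have h1 : ∫ t in Ioi (0 : ℝ), (t : ℂ) ^ (z - 1) • (oscIntegral f (σ / 2 * t) - ∫ x, f x) =
      ∫ t in Ioi (0 : ℝ), ∫ x, F t x := by
    congr 1
    funext t
    rw [oscIntegral, ← integral_sub (integrable_mul_exp_I f _) f.integrable, smul_eq_mul,
      ← integral_const_mul]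
    congr 1
    funext x
    simp only [hF]
    rw [show -(-(Complex.I * ((σ / 2 * P x : ℝ) : ℂ))) * t =
      Complex.I * ((σ / 2 * t * P x : ℝ) : ℂ) by push_cast; ring]
    ring
  rw [h1, integral_integral_swap hFint, zetaIntegral, zetaIntegral, ← integral_const_mul,
    ← integral_const_mul, ← integral_add ((hint _).const_mul _) ((hint _).const_mul _),
    ← integral_const_mul]
  congr 1
  funext x
  have h2 := mellin_exp_I_mul_sub_one hz hz' (σ / 2 * P x)
  rw [mellin] at h2
  simp only [smul_eq_mul] at h2
  simp only [hF, neg_neg]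
  rw [integral_const_mul, h2]
  have habs : ((|σ / 2 * P x| : ℝ) : ℂ) ^ (-z) = (2 : ℂ) ^ z * ((|P x| : ℝ) : ℂ) ^ (-z) := by
    rw [abs_mul, abs_div, hσabs, abs_two, one_div, Complex.ofReal_mul,
      Complex.mul_cpow_ofReal_nonneg (by norm_num) (abs_nonneg _)]
    congr 1
    rw [Complex.ofReal_inv, Complex.inv_cpow _ _ (by simp [Real.pi_pos.ne]), Complex.cpow_neg, inv_inv]
    simp
  have hsign : Real.sign (σ / 2 * P x) = σ * Real.sign (P x) := by
    rcases hσ with rfl | rfl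
    · rcases lt_trichotomy (P x) 0 with h | h | h
      · rw [Real.sign_of_neg h, Real.sign_of_neg (by linarith), one_mul]
      · simp [h]
      · rw [Real.sign_of_pos h, Real.sign_of_pos (by linarith), one_mul]
    · rcases lt_trichotomy (P x) 0 with h | h | h
      · rw [Real.sign_of_neg h, Real.sign_of_pos (by linarith)]
        norm_num
      · simp [h]
      · rw [Real.sign_of_pos h, Real.sign_of_neg (by linarith), mul_one]
  rw [habs, hsign, detPow, detPow]
  push_cast
  ring

/-! ### Convergence and analyticity of the zeta integrals for Re s > 0 -/

theorem norm_detPow_le {p q : ℕ} (ε : Parity) {s : ℂ} (hs : 0 < s.re) (x : V p q) :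
    ‖detPow ε s x‖ ≤ |P x| ^ s.re := by
  cases ε
  · rw [detPow, Complex.norm_cpow_eq_rpow_re_of_nonneg (abs_nonneg _) hs.ne']
  · rw [detPow, norm_mul, Complex.norm_cpow_eq_rpow_re_of_nonneg (abs_nonneg _) hs.ne']
    refine mul_le_of_le_one_left (Real.rpow_nonneg (abs_nonneg _) _) ?_
    rcases Real.sign_apply_eq (P x) with h | h | h <;> simp [h]

theorem measurable_detPow {p q : ℕ} (ε : Parity) (s : ℂ) : Measurable (detPow ε s : V p q → ℂ) := by
  have hP : Measurable (P : V p q → ℝ) := continuous_P.measurable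
  have h1 : Measurable fun x : V p q => ((|P x| : ℝ) : ℂ) ^ s :=
    (Complex.measurable_ofReal.comp hP.abs).pow_const s
  cases ε
  · exact h1
  · refine Measurable.mul (Complex.measurable_ofReal.comp ?_) h1
    unfold Real.sign
    exact Measurable.ite (measurableSet_lt hP measurable_const) measurable_const
      (Measurable.ite (measurableSet_lt measurable_const hP) measurable_const measurable_const)

theorem rpow_le_one_add_pow {x : ℝ} (hx : 0 ≤ x) {σ : ℝ} (hσ : 0 ≤ σ) {N : ℕ} (hN : σ ≤ N) :
    x ^ σ ≤ 1 + x ^ N := by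
  rcases le_total x 1 with h | h
  · have := Real.rpow_le_one hx h hσ
    linarith [pow_nonneg hx N]
  · have := Real.rpow_le_rpow_of_exponent_le h hN
    rw [Real.rpow_natCast] at this
    linarith

/-- Near 0 the power `x ^ δ` absorbs the logarithm; for `x ≥ 1` one more power of `x` does. -/
theorem abs_log_mul_rpow_le {x : ℝ} (hx : 0 ≤ x) {δ σ : ℝ} (hδ : 0 < δ) (hσ : δ ≤ σ) {N : ℕ}
    (hN : σ ≤ N) : |Real.log x| * x ^ σ ≤ 1 / δ + x ^ (N + 1) := by
  rcases hx.eq_or_lt with rfl | hx0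
  · simp only [Real.log_zero, abs_zero, zero_mul]
    positivity
  rcases le_total x 1 with h | h
  · have h1 := (Real.abs_log_mul_self_rpow_lt x δ hx0 h hδ).le
    rw [abs_mul, abs_of_nonneg (Real.rpow_nonneg hx δ)] at h1
    have h2 := mul_le_mul_of_nonneg_left (Real.rpow_le_rpow_of_exponent_ge hx0 h hσ)
      (abs_nonneg (Real.log x))
    linarith [pow_nonneg hx (N + 1)]
  · have h1 : |Real.log x| ≤ x := by
      rw [abs_of_nonneg (Real.log_nonneg h)]
      exact Real.log_le_self hx
    have h2 := Real.rpow_le_rpow_of_exponent_le h hN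
    rw [Real.rpow_natCast] at h2
    have h3 := mul_le_mul h1 h2 (Real.rpow_nonneg hx _) hx
    rw [pow_succ']
    have : 0 < 1 / δ := by positivity
    linarith

theorem integrable_mul_detPow (ε : Parity) (f : 𝓢(V p q, ℂ)) {s : ℂ} (hs : 0 < s.re) :
    Integrable fun x => f x * detPow ε s x := by
  obtain ⟨N, hN⟩ := exists_nat_ge s.re
  refine ((integrable_norm_mul_abs_P_pow f 0).add (integrable_norm_mul_abs_P_pow f N)).mono'
    (f.continuous.measurable.mul (measurable_detPow ε s)).aestronglyMeasurable
    (Eventually.of_forall fun x => ?_)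
  rw [norm_mul, Pi.add_apply, ← mul_add, pow_zero]
  exact mul_le_mul_of_nonneg_left ((norm_detPow_le ε hs x).trans
    (rpow_le_one_add_pow (abs_nonneg _) hs.le hN)) (norm_nonneg _)

theorem hasDerivAt_detPow (ε : Parity) (x : V p q) {s : ℂ} (hs : 0 < s.re) :
    HasDerivAt (fun s => detPow ε s x) (((Real.log |P x| : ℝ) : ℂ) * detPow ε s x) s := by
  have hs0 : s ≠ 0 := by rintro rfl; simp at hs
  -- Where `P x = 0` the power is 0 for all nearby exponents, in agreement with the convention `log
  -- 0 = 0`.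
  have h1 := (hasDerivAt_id s).const_cpow (c := ((|P x| : ℝ) : ℂ)) (Or.inr hs0)
  rw [← Complex.ofReal_log (abs_nonneg _)] at h1
  cases ε
  · refine h1.congr_deriv ?_
    simp only [detPow, id]
    ring
  · refine (h1.const_mul ((Real.sign (P x) : ℝ) : ℂ)).congr_deriv ?_
    simp only [detPow, id]
    ring

theorem differentiableAt_zetaIntegral (ε : Parity) (f : 𝓢(V p q, ℂ)) {s : ℂ} (hs : 0 < s.re) :
    DifferentiableAt ℂ (zetaIntegral ε f) s := by
  set δ : ℝ := s.re / 2 with hδ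
  have hδ0 : 0 < δ := by positivity
  obtain ⟨N, hN⟩ := exists_nat_ge (s.re + 1)
  have hU : {z : ℂ | δ < z.re ∧ z.re < s.re + 1} ∈ 𝓝 s :=
    ((isOpen_lt continuous_const Complex.continuous_re).inter
      (isOpen_lt Complex.continuous_re continuous_const)).mem_nhds
      ⟨by show δ < s.re; linarith, by show s.re < s.re + 1; linarith⟩
  have hmeas : ∀ z, AEStronglyMeasurable (fun x : V p q => f x * detPow ε z x) := fun z =>
    (f.continuous.measurable.mul (measurable_detPow ε z)).aestronglyMeasurable
  have hlog : Measurable fun x : V p q => ((Real.log |P x| : ℝ) : ℂ) :=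
    Complex.measurable_ofReal.comp (Real.measurable_log.comp continuous_P.measurable.abs)
  refine (hasDerivAt_integral_of_dominated_loc_of_deriv_le
    (F := fun z x => f x * detPow ε z x)
    (F' := fun z x => f x * (((Real.log |P x| : ℝ) : ℂ) * detPow ε z x))
    (bound := fun x => 1 / δ * (‖f x‖ * |P x| ^ 0) + ‖f x‖ * |P x| ^ (N + 1)) hU
    (Eventually.of_forall hmeas) (integrable_mul_detPow ε f hs)
    (f.continuous.measurable.mul (hlog.mul (measurable_detPow ε s))).aestronglyMeasurable
    (Eventually.of_forall fun x z hz => ?_)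
    (((integrable_norm_mul_abs_P_pow f 0).const_mul _).add (integrable_norm_mul_abs_P_pow f _))
    (Eventually.of_forall fun x z hz =>
      (hasDerivAt_detPow ε x (hδ0.trans hz.1)).const_mul _)).2.differentiableAt
  rw [norm_mul, norm_mul, Complex.norm_real, Real.norm_eq_abs]
  have h1 := (mul_le_mul_of_nonneg_left (norm_detPow_le ε (hδ0.trans hz.1) x)
    (abs_nonneg (Real.log |P x|))).trans
    (abs_log_mul_rpow_le (abs_nonneg (P x)) hδ0 hz.1.le (hz.2.le.trans hN))
  refine (mul_le_mul_of_nonneg_left h1 (norm_nonneg (f x))).trans_eq ?_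
  ring

theorem analyticAt_zetaIntegral (ε : Parity) (f : 𝓢(V p q, ℂ)) {s : ℂ} (hs : 0 < s.re) :
    AnalyticAt ℂ (zetaIntegral ε f) s :=
  DifferentiableOn.analyticAt (s := {z : ℂ | 0 < z.re})
    (fun _ hz => (differentiableAt_zetaIntegral ε f hz).differentiableWithinAt)
    ((isOpen_lt continuous_const Complex.continuous_re).mem_nhds hs)

/-! ### Meromorphic continuation of the zeta integrals -/

/-- Identity theorem for meromorphic functions. -/
theorem eventuallyEq_nhdsNE_of_isPreconnected {F G : ℂ → ℂ} {U : Set ℂ} (hF : MeromorphicOn F U)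
    (hG : MeromorphicOn G U) (hU : IsPreconnected U) {x y : ℂ} (hx : x ∈ U) (hy : y ∈ U)
    (h : F =ᶠ[𝓝[≠] x] G) : F =ᶠ[𝓝[≠] y] G := by
  by_contra hne
  have hy' : meromorphicOrderAt (F - G) y ≠ ⊤ := by
    intro htop
    refine hne ?_
    filter_upwards [meromorphicOrderAt_eq_top_iff.1 htop] with z hz
    exact sub_eq_zero.1 hz
  refine (hF.sub hG).meromorphicOrderAt_ne_top_of_isPreconnected hU hy hx hy'
    (meromorphicOrderAt_eq_top_iff.2 ?_)
  filter_upwards [h] with z hz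
  exact sub_eq_zero.2 hz

/-- A meromorphic function on the plane that extends the zeta integral. -/
noncomputable def zetaExt (ε : Parity) (f : 𝓢(V p q, ℂ)) (s : ℂ) : ℂ :=
  match ε with
  | Parity.plus => (2 : ℂ) ^ s * (Complex.Gamma (-s))⁻¹ *
      (oscMellin f 1 (-s) + oscMellin f (-1) (-s)) / (2 * Complex.cos (Real.pi * s / 2))
  | Parity.minus => (2 : ℂ) ^ s * (Complex.Gamma (-s))⁻¹ *
      (oscMellin f 1 (-s) - oscMellin f (-1) (-s)) /
        (-(2 * Complex.I * Complex.sin (Real.pi * s / 2)))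

theorem meromorphicAt_zetaExt (ε : Parity) (f : 𝓢(V p q, ℂ)) (s : ℂ) :
    MeromorphicAt (zetaExt ε f) s := by
  have h2 : MeromorphicAt (fun s : ℂ => (2 : ℂ) ^ s) s := by
    have : Differentiable ℂ fun s : ℂ => (2 : ℂ) ^ s := fun s =>
      ((hasDerivAt_id s).const_cpow (Or.inl two_ne_zero)).differentiableAt
    exact (this.analyticAt s).meromorphicAt
  have hΓ : MeromorphicAt (fun s : ℂ => (Complex.Gamma (-s))⁻¹) s := by
    have : Differentiable ℂ fun s : ℂ => (Complex.Gamma (-s))⁻¹ :=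
      Complex.differentiable_one_div_Gamma.comp differentiable_neg
    exact (this.analyticAt s).meromorphicAt
  have hM : ∀ σ : ℝ, MeromorphicAt (fun s : ℂ => oscMellin f σ (-s)) s := fun σ =>
    MeromorphicAt.comp_analyticAt (meromorphicAt_oscMellin f σ (-s)) (g := fun s => -s)
      (by fun_prop)
  have hcos : MeromorphicAt (fun s : ℂ => 2 * Complex.cos (Real.pi * s / 2)) s := by
    have : Differentiable ℂ fun s : ℂ => 2 * Complex.cos (Real.pi * s / 2) := by fun_prop
    exact (this.analyticAt s).meromorphicAt
  have hsin : MeromorphicAt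
      (fun s : ℂ => -(2 * Complex.I * Complex.sin (Real.pi * s / 2))) s := by
    have : Differentiable ℂ fun s : ℂ => -(2 * Complex.I * Complex.sin (Real.pi * s / 2)) := by
      fun_prop
    exact (this.analyticAt s).meromorphicAt
  cases ε
  · exact ((h2.mul hΓ).mul ((hM 1).add (hM (-1)))).div hcos
  · exact ((h2.mul hΓ).mul ((hM 1).sub (hM (-1)))).div hsin

theorem sin_pi_mul_ne_zero_of_re_mem {s : ℂ} (hs : 0 < s.re) (hs' : s.re < 1) :
    Complex.sin (Real.pi * s) ≠ 0 := by
  rw [Complex.sin_ne_zero_iff]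
  intro k hk
  have hpi : (Real.pi : ℂ) ≠ 0 := by exact_mod_cast Real.pi_pos.ne'
  have h1 : s = k := mul_left_cancel₀ hpi (by rw [hk, mul_comm])
  rw [h1, Complex.intCast_re] at hs hs'
  have h2 : 0 < k := by exact_mod_cast hs
  have h3 : k < 1 := by exact_mod_cast hs'
  omega

theorem sin_eq_two_mul (s : ℂ) : Complex.sin (Real.pi * s) =
    2 * Complex.sin (Real.pi * s / 2) * Complex.cos (Real.pi * s / 2) := by
  rw [← Complex.sin_two_mul]
  congr 1
  ring

theorem Gamma_neg_mul (s : ℂ) : Complex.Gamma (-s) * Complex.Gamma (s + 1) =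
    -(Real.pi / Complex.sin (Real.pi * s)) := by
  have := Complex.Gamma_mul_Gamma_one_sub (-s)
  rw [sub_neg_eq_add, add_comm, mul_neg, Complex.sin_neg, div_neg] at this
  exact this

theorem Gamma_neg_ne_zero {s : ℂ} (hs : Complex.sin (Real.pi * s) ≠ 0) :
    Complex.Gamma (-s) ≠ 0 := by
  refine left_ne_zero_of_mul (b := Complex.Gamma (s + 1)) ?_
  rw [Gamma_neg_mul]
  exact neg_ne_zero.2 (div_ne_zero (by exact_mod_cast Real.pi_pos.ne') hs)

/-- Sum and difference over `σ = ±1` of the strip formula at `z = -s` isolate the two zeta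
integrals; `sin πs ≠ 0` keeps all divisors nonzero. -/
theorem zetaExt_eq_zetaIntegral (hn : 0 < p + q) (ε : Parity) (f : 𝓢(V p q, ℂ)) {s : ℂ}
    (hs : 0 < s.re) (hs' : s.re < 1) : zetaExt ε f s = zetaIntegral ε f s := by
  have hsin := sin_pi_mul_ne_zero_of_re_mem hs hs'
  have hΓ := Gamma_neg_ne_zero hsin
  rw [sin_eq_two_mul] at hsin
  have h1 : Complex.sin (Real.pi * s / 2) ≠ 0 :=
    right_ne_zero_of_mul (left_ne_zero_of_mul hsin)
  have h2 : Complex.cos (Real.pi * s / 2) ≠ 0 := right_ne_zero_of_mul hsin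
  have hM : ∀ σ : ℝ, σ = 1 ∨ σ = -1 → oscMellin f σ (-s) =
      Complex.Gamma (-s) * ((2 : ℂ) ^ s)⁻¹ *
        (Complex.cos (Real.pi * s / 2) * zetaIntegral Parity.plus f s -
          Complex.I * σ * Complex.sin (Real.pi * s / 2) * zetaIntegral Parity.minus f s) := by
    intro σ hσ
    rw [oscMellin_eq_zetaIntegral hn f hσ (z := -s) (by simpa using hs') (by simpa using hs)
      (fun ε => by rw [neg_neg]; exact integrable_mul_detPow ε f hs), neg_neg, Complex.cpow_neg,
      mul_neg, neg_div, Complex.cos_neg, Complex.sin_neg]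
    ring
  have hpow : (2 : ℂ) ^ s ≠ 0 := (Complex.cpow_ne_zero_iff).2 (Or.inl two_ne_zero)
  have hI := Complex.I_ne_zero
  cases ε <;> rw [zetaExt, hM 1 (Or.inl rfl), hM (-1) (Or.inr rfl)] <;> push_cast <;>
    generalize Complex.cos (Real.pi * s / 2) = c at * <;>
    generalize Complex.sin (Real.pi * s / 2) = d at * <;> field_simp <;> ring

/-- Agreement on the strip `0 < re s < 1` around `1/2` propagates through `U`, which is later the
right half-plane or the whole plane. -/
theorem zetaExt_eventuallyEq (hn : 0 < p + q) (ε : Parity) (f : 𝓢(V p q, ℂ)) {F : ℂ → ℂ}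
    {U : Set ℂ} (hF : MeromorphicOn F U) (hU : IsPreconnected U) (hhalf : (1 / 2 : ℂ) ∈ U)
    (hFz : ∀ s : ℂ, 0 < s.re → F s = zetaIntegral ε f s) {s : ℂ} (hs : s ∈ U) :
    F =ᶠ[𝓝[≠] s] zetaExt ε f := by
  refine eventuallyEq_nhdsNE_of_isPreconnected hF
    (fun z _ => meromorphicAt_zetaExt ε f z) hU hhalf hs ?_
  have hmem : {z : ℂ | 0 < z.re ∧ z.re < 1} ∈ 𝓝 (1 / 2 : ℂ) :=
    ((isOpen_lt continuous_const Complex.continuous_re).inter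
      (isOpen_lt Complex.continuous_re continuous_const)).mem_nhds
      ⟨by show (0 : ℝ) < (1 / 2 : ℂ).re; norm_num, by show (1 / 2 : ℂ).re < 1; norm_num⟩
  filter_upwards [nhdsWithin_le_nhds hmem] with z hz
  rw [hFz z hz.1, zetaExt_eq_zetaIntegral hn ε f hz.1 hz.2]

/-- The formula for `zetaExt` can degenerate at isolated points with `re s > 0`. Passing to normal
form repairs this: the zeta integral is analytic there, and normal forms with equal germs have equal
values. -/
theorem isZetaContinuation_toMeromorphicNFOn (hn : 0 < p + q) (ε : Parity) (f : 𝓢(V p q, ℂ)) :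
    IsZetaContinuation ε f (toMeromorphicNFOn (zetaExt ε f) univ) := by
  refine ⟨meromorphicNFOn_toMeromorphicNFOn _ _, fun s hs => ?_⟩
  have hmer : MeromorphicOn (zetaExt ε f) univ := fun z _ => meromorphicAt_zetaExt ε f z
  have h1 := hmer.toMeromorphicNFOn_eq_self_on_nhdsNE (mem_univ s)
  have h2 : zetaIntegral ε f =ᶠ[𝓝[≠] s] zetaExt ε f :=
    zetaExt_eventuallyEq hn ε f (U := {z : ℂ | 0 < z.re})
      (fun z hz => (analyticAt_zetaIntegral ε f hz).meromorphicAt)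
      (convex_halfSpace_re_gt 0).isPreconnected (by simp) (fun _ _ => rfl) hs
  exact (((meromorphicNFOn_toMeromorphicNFOn _ _
    (mem_univ s)).eventuallyEq_nhdsNE_iff_eventuallyEq_nhds
    (analyticAt_zetaIntegral ε f hs).meromorphicNFAt).1 (h1.trans h2.symm)).eq_of_nhds

theorem isZetaContinuation_Z (hn : 0 < p + q) (ε : Parity) (f : 𝓢(V p q, ℂ)) :
    IsZetaContinuation ε f (Z ε f) := by
  have h : ∃ F : ℂ → ℂ, IsZetaContinuation ε f F :=
    ⟨_, isZetaContinuation_toMeromorphicNFOn hn ε f⟩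
  rw [Z, dif_pos h]
  exact h.choose_spec

theorem Z_eventuallyEq_zetaExt (hn : 0 < p + q) (ε : Parity) (f : 𝓢(V p q, ℂ)) (s : ℂ) :
    Z ε f =ᶠ[𝓝[≠] s] zetaExt ε f :=
  have h := isZetaContinuation_Z hn ε f
  zetaExt_eventuallyEq hn ε f h.1.meromorphicOn isPreconnected_univ (mem_univ _) h.2 (mem_univ s)

/-! ### The matrix functional equation -/

theorem oscMellin_eq_zetaExt (f : 𝓢(V p q, ℂ)) {s : ℂ} (hs : Complex.sin (Real.pi * s) ≠ 0)
    {σ : ℝ} (hσ : σ = 1 ∨ σ = -1) :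
    oscMellin f σ (-s) = Complex.Gamma (-s) * ((2 : ℂ) ^ s)⁻¹ *
      (Complex.cos (Real.pi * s / 2) * zetaExt Parity.plus f s -
        Complex.I * σ * Complex.sin (Real.pi * s / 2) * zetaExt Parity.minus f s) := by
  have hΓ := Gamma_neg_ne_zero hs
  rw [sin_eq_two_mul] at hs
  have h1 : Complex.sin (Real.pi * s / 2) ≠ 0 := right_ne_zero_of_mul (left_ne_zero_of_mul hs)
  have h2 : Complex.cos (Real.pi * s / 2) ≠ 0 := right_ne_zero_of_mul hs
  have hpow : (2 : ℂ) ^ s ≠ 0 := (Complex.cpow_ne_zero_iff).2 (Or.inl two_ne_zero)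
  have hI := Complex.I_ne_zero
  simp only [zetaExt]
  generalize Complex.cos (Real.pi * s / 2) = c at *
  generalize Complex.sin (Real.pi * s / 2) = d at *
  rcases hσ with rfl | rfl <;> push_cast <;> field_simp <;> ring

theorem oscConst_eq (p q : ℕ) {σ : ℝ} (hσ : σ = 1 ∨ σ = -1) :
    oscConst p q σ = ((2 * Real.pi : ℝ) : ℂ) ^ (((p : ℂ) + q) / 2) *
      (Complex.cos (((p : ℂ) - q) * Real.pi / 4) +
        Complex.I * σ * Complex.sin (((p : ℂ) - q) * Real.pi / 4)) := by
  rw [oscConst, mul_comm Complex.I (_ * _), Complex.exp_mul_I]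
  rcases hσ with rfl | rfl
  · push_cast
    rw [one_mul]
    ring
  · push_cast
    rw [neg_one_mul, Complex.cos_neg, Complex.sin_neg]
    ring

/-- The power of `2π` and the Gamma factors of the functional equation combine to `γ`. -/
theorem gamma_factor (p q : ℕ) {s : ℂ} (hs : Complex.sin (Real.pi * s) ≠ 0) :
    (2 : ℂ) ^ s * (Complex.Gamma (-s))⁻¹ * ((2 * Real.pi : ℝ) : ℂ) ^ (((p : ℂ) + q) / 2) *
      (Complex.Gamma (s + ((p : ℂ) + q) / 2) * ((2 : ℂ) ^ (-s - ((p : ℂ) + q) / 2))⁻¹) =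
    -(γ (p + q) s * Complex.sin (Real.pi * s)) := by
  have hΓ := Gamma_neg_ne_zero hs
  have hpi : (Real.pi : ℂ) ≠ 0 := by exact_mod_cast Real.pi_pos.ne'
  -- The reflection formula trades `1 / Γ(-s)` for the factor `Γ(s + 1)` of `γ`.
  have hinv : (Complex.Gamma (-s))⁻¹ =
      -(Complex.Gamma (s + 1) * Complex.sin (Real.pi * s) / Real.pi) := by
    have := Gamma_neg_mul s
    generalize Complex.sin (Real.pi * s) = S at *
    field_simp at this ⊢
    linear_combination this
  have h2 : (2 : ℂ) ^ (2 * s + ((p : ℂ) + q)) = (2 : ℂ) ^ s * (2 : ℂ) ^ (((p : ℂ) + q) / 2) *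
      ((2 : ℂ) ^ (-s - ((p : ℂ) + q) / 2))⁻¹ := by
    rw [← Complex.cpow_neg, ← Complex.cpow_add _ _ two_ne_zero, ← Complex.cpow_add _ _ two_ne_zero]
    congr 1
    ring
  have h2pi : ((2 * Real.pi : ℝ) : ℂ) ^ (((p : ℂ) + q) / 2) =
      (2 : ℂ) ^ (((p : ℂ) + q) / 2) * (Real.pi : ℂ) ^ (((p : ℂ) + q) / 2) := by
    rw [Complex.ofReal_mul, Complex.mul_cpow_ofReal_nonneg zero_le_two Real.pi_pos.le,
      Complex.ofReal_ofNat]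
  rw [hinv, h2pi, γ, Nat.cast_add, h2, Complex.cpow_sub _ _ hpi, Complex.cpow_one]
  field_simp

theorem sin_pi_mul_ne_zero_of_two {s : ℂ} (hs : Complex.sin (2 * Real.pi * s) ≠ 0) :
    Complex.sin (Real.pi * s) ≠ 0 := by
  rw [mul_assoc, Complex.sin_two_mul] at hs
  exact right_ne_zero_of_mul (left_ne_zero_of_mul hs)

/-- Excluding the zeros of `sin 2πs` keeps both `s` and `-s - n/2` away from the integers, for
either parity of `n`, so the linear system is invertible at both points. -/
theorem functionalEquation_zetaExt (f : 𝓢(V p q, ℂ)) {s : ℂ}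
    (hs : Complex.sin (2 * Real.pi * s) ≠ 0) :
    ![zetaExt Parity.plus (fhat f) s, zetaExt Parity.minus (fhat f) s] =
      γ (p + q) s • (A p q s).mulVec
        ![zetaExt Parity.plus f (-s - ((p + q : ℕ) : ℂ) / 2),
          zetaExt Parity.minus f (-s - ((p + q : ℕ) : ℂ) / 2)] := by
  have hs1 := sin_pi_mul_ne_zero_of_two hs
  have hs2 : Complex.sin (Real.pi * (-s - ((p + q : ℕ) : ℂ) / 2)) ≠ 0 := by
    refine sin_pi_mul_ne_zero_of_two ?_
    have e : 2 * (Real.pi : ℂ) * (-s - ((p + q : ℕ) : ℂ) / 2) =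
        -(2 * Real.pi * s + (p + q : ℕ) * Real.pi) := by ring
    rw [e, Complex.sin_neg, Complex.sin_antiperiodic.add_nat_mul_eq]
    exact neg_ne_zero.2 (mul_ne_zero (pow_ne_zero _ (by norm_num)) hs)
  have hMf : ∀ σ : ℝ, σ = 1 ∨ σ = -1 → _ := fun σ hσ => oscMellin_eq_zetaExt f hs2 hσ
  have hcast : ((p + q : ℕ) : ℂ) = (p : ℂ) + q := by push_cast; ring
  rw [hcast] at hMf ⊢
  set k : ℂ := ((p : ℂ) + q) / 2 with hk
  set X : ℂ := Real.pi * s / 2 with hX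
  set Y : ℂ := X + ((p : ℂ) + q) * Real.pi / 4 with hY
  set δ : ℂ := ((p : ℂ) - q) * Real.pi / 4 with hδ
  set Zp : ℂ := zetaExt Parity.plus f (-s - k)
  set Zm : ℂ := zetaExt Parity.minus f (-s - k)
  have hY' : Real.pi * (-s - k) / 2 = -Y := by rw [hY, hX, hk]; ring
  have hneg : -(-s - k) = s + k := by ring
  have hMfhat : ∀ σ : ℝ, σ = 1 ∨ σ = -1 → oscMellin (fhat f) σ (-s) =
      ((2 * Real.pi : ℝ) : ℂ) ^ k * (Complex.cos δ + Complex.I * σ * Complex.sin δ) *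
        (Complex.Gamma (s + k) * ((2 : ℂ) ^ (-s - k))⁻¹ *
          (Complex.cos Y * Zp - Complex.I * σ * Complex.sin Y * Zm)) := by
    intro σ hσ
    have hσ' : -σ = 1 ∨ -σ = -1 := by rcases hσ with rfl | rfl <;> simp
    have h1 := hMf (-σ) hσ'
    rw [hneg, hY', Complex.cos_neg, Complex.sin_neg] at h1
    rw [oscMellin_fhat f hσ, sub_neg_eq_add, add_comm k s, h1, oscConst_eq p q hσ]
    push_cast
    ring
  have hg := gamma_factor p q hs1
  have hsXY : Complex.sin (Real.pi * s) = 2 * Complex.sin X * Complex.cos X := sin_eq_two_mul s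
  rw [hsXY] at hs1 hg
  have hsin : Complex.sin X ≠ 0 := right_ne_zero_of_mul (left_ne_zero_of_mul hs1)
  have hcos : Complex.cos X ≠ 0 := right_ne_zero_of_mul hs1
  -- The angles `nπ/4` and `(s + n/4)π` of `A` are `Y - X` and `Y + X`, where `2X = πs` and `2Y =
  -- π(s + n/2)`.
  have ha : ((p : ℂ) + q) * Real.pi / 4 = Y - X := by rw [hY]; ring
  have hb : (s + ((p : ℂ) + q) / 4) * Real.pi = Y + X := by rw [hY, hX]; ring
  rw [← hk] at hg
  clear_value X Y δ k
  -- Dividing `-2γ sin X cos X` by `cos X` here, and by `sin X` in `hminus`, leaves products such as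
  -- `-2 cos Y sin X = sin(Y - X) - sin(Y + X)`.
  have hplus : zetaExt Parity.plus (fhat f) s = γ (p + q) s *
      (Complex.cos δ * (Complex.sin (Y - X) - Complex.sin (Y + X)) * Zp +
        Complex.sin δ * (Complex.cos (Y + X) - Complex.cos (Y - X)) * Zm) := by
    rw [zetaExt, hMfhat 1 (Or.inl rfl), hMfhat (-1) (Or.inr rfl), ← hX,
      div_eq_iff (mul_ne_zero two_ne_zero hcos), Complex.sin_add, Complex.sin_sub,
      Complex.cos_add, Complex.cos_sub]
    simp only [Complex.ofReal_one, Complex.ofReal_neg]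
    linear_combination (2 * (Complex.cos δ * Complex.cos Y * Zp -
        Complex.I ^ 2 * Complex.sin δ * Complex.sin Y * Zm)) * hg +
      4 * γ (p + q) s * Complex.sin X * Complex.cos X * Complex.sin δ * Complex.sin Y * Zm *
        Complex.I_sq
  have hminus : zetaExt Parity.minus (fhat f) s = γ (p + q) s *
      (Complex.sin δ * (Complex.cos (Y + X) + Complex.cos (Y - X)) * Zp -
        Complex.cos δ * (Complex.sin (Y - X) + Complex.sin (Y + X)) * Zm) := by
    rw [zetaExt, hMfhat 1 (Or.inl rfl), hMfhat (-1) (Or.inr rfl), ← hX,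
      div_eq_iff (neg_ne_zero.2 (mul_ne_zero (mul_ne_zero two_ne_zero Complex.I_ne_zero) hsin)),
      Complex.sin_add, Complex.sin_sub, Complex.cos_add, Complex.cos_sub]
    simp only [Complex.ofReal_one, Complex.ofReal_neg]
    linear_combination (2 * Complex.I * (Complex.sin δ * Complex.cos Y * Zp -
        Complex.cos δ * Complex.sin Y * Zm)) * hg
  rw [hplus, hminus]
  simp only [A, ← hδ]
  rw [ha, hb]
  ext i
  fin_cases i <;> simp [-mul_eq_mul_left_iff] <;> ring

/-! ### From the generic identity to germs and values -/

theorem eventually_sin_ne_zero (s₀ : ℂ) :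
    ∀ᶠ s in 𝓝[≠] s₀, Complex.sin (2 * Real.pi * s) ≠ 0 := by
  have hd : Differentiable ℂ fun s : ℂ => Complex.sin (2 * Real.pi * s) := by fun_prop
  refine (hd.analyticAt s₀).eventually_eq_zero_or_eventually_ne_zero.resolve_left fun h => ?_
  have h1 : HasDerivAt (fun s : ℂ => Complex.sin (2 * Real.pi * s))
      (Complex.cos (2 * Real.pi * s₀) * (2 * Real.pi * 1)) s₀ :=
    ((hasDerivAt_id s₀).const_mul _).csin
  have h2 := (h1.congr_of_eventuallyEq (f₁ := fun _ => 0) (h.mono fun _ h => h.symm)).unique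
    (hasDerivAt_const s₀ (0 : ℂ))
  have hpi : (Real.pi : ℂ) ≠ 0 := by exact_mod_cast Real.pi_pos.ne'
  have h3 : Complex.cos (2 * Real.pi * s₀) = 0 := by
    simpa [hpi] using h2
  have h4 := Complex.sin_sq_add_cos_sq (2 * Real.pi * s₀)
  rw [h3, h.self_of_nhds] at h4
  norm_num at h4

theorem eventually_functionalEquation (hn : 0 < p + q) (f : 𝓢(V p q, ℂ)) (s₀ : ℂ) :
    ∀ᶠ s in 𝓝[≠] s₀, FunctionalEquation f s := by
  have hrefl : Tendsto (fun s : ℂ => -s - ((p + q : ℕ) : ℂ) / 2) (𝓝[≠] s₀)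
      (𝓝[≠] (-s₀ - ((p + q : ℕ) : ℂ) / 2)) := by
    refine tendsto_nhdsWithin_iff.2 ⟨?_, ?_⟩
    · have : Continuous fun s : ℂ => -s - ((p + q : ℕ) : ℂ) / 2 := by fun_prop
      exact (this.tendsto s₀).mono_left nhdsWithin_le_nhds
    · filter_upwards [self_mem_nhdsWithin] with s hs
      simpa using hs
  filter_upwards [eventually_sin_ne_zero s₀, Z_eventuallyEq_zetaExt hn Parity.plus (fhat f) s₀,
    Z_eventuallyEq_zetaExt hn Parity.minus (fhat f) s₀,
    hrefl.eventually (Z_eventuallyEq_zetaExt hn Parity.plus f _),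
    hrefl.eventually (Z_eventuallyEq_zetaExt hn Parity.minus f _)] with s h0 h1 h2 h3 h4
  rw [FunctionalEquation, h1, h2, h3, h4]
  exact functionalEquation_zetaExt f h0

/-- The right-hand side is analytic at `s`, hence in normal form, as is `Z` of `fhat f` by
construction; equality on a punctured neighbourhood therefore extends to `s`. -/
theorem functionalEquation_of_analyticAt (hn : 0 < p + q) (f : 𝓢(V p q, ℂ)) {s : ℂ}
    (h1 : ∀ m : ℕ, s + 1 ≠ -(m : ℂ)) (h2 : ∀ m : ℕ, s + ((p + q : ℕ) : ℂ) / 2 ≠ -(m : ℂ))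
    (h3 : ∀ ε : Parity, AnalyticAt ℂ (Z ε f) (-s - ((p + q : ℕ) : ℂ) / 2)) :
    FunctionalEquation f s := by
  have hγ : AnalyticAt ℂ (γ (p + q)) s := by
    have hG : ∀ w : ℂ, (∀ m : ℕ, w ≠ -(m : ℂ)) → AnalyticAt ℂ Complex.Gamma w := by
      intro w hw
      have hinv : AnalyticAt ℂ (fun w => (Complex.Gamma w)⁻¹) w :=
        Complex.differentiable_one_div_Gamma.analyticAt w
      exact (hinv.inv (inv_ne_zero (Complex.Gamma_ne_zero hw))).congr
        (Eventually.of_forall fun _ => inv_inv _)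
    have hpow : Differentiable ℂ fun s : ℂ => (2 : ℂ) ^ (2 * s + ((p + q : ℕ) : ℂ)) := by
      intro z
      exact DifferentiableAt.const_cpow (by fun_prop) (Or.inl two_ne_zero)
    have hG1 : AnalyticAt ℂ (fun s : ℂ => Complex.Gamma (s + 1)) s :=
      (hG _ h1).fun_comp (f := fun s : ℂ => s + 1) (by fun_prop)
    have hG2 : AnalyticAt ℂ (fun s : ℂ => Complex.Gamma (s + ((p + q : ℕ) : ℂ) / 2)) s :=
      (hG _ h2).fun_comp (f := fun s : ℂ => s + ((p + q : ℕ) : ℂ) / 2) (by fun_prop)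
    exact (((hpow.analyticAt s).mul analyticAt_const).mul hG1).mul hG2
  have hZ : ∀ ε, AnalyticAt ℂ (fun s => Z ε f (-s - ((p + q : ℕ) : ℂ) / 2)) s := fun ε =>
    (h3 ε).fun_comp (f := fun s : ℂ => -s - ((p + q : ℕ) : ℂ) / 2) (by fun_prop)
  have hA : ∀ i j, AnalyticAt ℂ (fun s => A p q s i j) s := by
    intro i j
    have : Differentiable ℂ fun s => A p q s i j := by
      fin_cases i <;> fin_cases j <;> simp [A] <;> fun_prop
    exact this.analyticAt s
  have hrow : ∀ i, AnalyticAt ℂ (fun s => γ (p + q) s * (A p q s i 0 *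
      Z Parity.plus f (-s - ((p + q : ℕ) : ℂ) / 2) +
        A p q s i 1 * Z Parity.minus f (-s - ((p + q : ℕ) : ℂ) / 2))) s := fun i =>
    hγ.mul (((hA i 0).mul (hZ _)).add ((hA i 1).mul (hZ _)))
  have hFE : ∀ z, FunctionalEquation f z ↔
      (Z Parity.plus (fhat f) z = γ (p + q) z * (A p q z 0 0 *
        Z Parity.plus f (-z - ((p + q : ℕ) : ℂ) / 2) +
          A p q z 0 1 * Z Parity.minus f (-z - ((p + q : ℕ) : ℂ) / 2))) ∧
      Z Parity.minus (fhat f) z = γ (p + q) z * (A p q z 1 0 *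
        Z Parity.plus f (-z - ((p + q : ℕ) : ℂ) / 2) +
          A p q z 1 1 * Z Parity.minus f (-z - ((p + q : ℕ) : ℂ) / 2)) := by
    intro z
    rw [FunctionalEquation, funext_iff, Fin.forall_fin_two]
    simp
  have hev := eventually_functionalEquation hn f s
  simp only [hFE] at hev
  rw [hFE]
  constructor
  · exact ((((isZetaContinuation_Z hn Parity.plus (fhat f)).1
      (mem_univ s)).eventuallyEq_nhdsNE_iff_eventuallyEq_nhds (hrow 0).meromorphicNFAt).1
      (hev.mono fun _ h => h.1)).eq_of_nhds
  · exact ((((isZetaContinuation_Z hn Parity.minus (fhat f)).1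
      (mem_univ s)).eventuallyEq_nhdsNE_iff_eventuallyEq_nhds (hrow 1).meromorphicNFAt).1
      (hev.mono fun _ h => h.2)).eq_of_nhds

end ZetaPQ

theorem mainTheorem7 (p q : ℕ) (hp : 2 ≤ p) (hq : 1 ≤ q) :
    -- the zeta integrals converge for `Re s > 0`, and `Z` is their meromorphic continuation
    (∀ (ε : ZetaPQ.Parity) (f : 𝓢(ZetaPQ.V p q, ℂ)),
      (∀ s : ℂ, 0 < s.re →
        MeasureTheory.Integrable (fun x : ZetaPQ.V p q => f x * ZetaPQ.detPow ε s x)) ∧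
      ZetaPQ.IsZetaContinuation ε f (ZetaPQ.Z ε f)) ∧
    ∀ f : 𝓢(ZetaPQ.V p q, ℂ),
      -- the functional equation, as an identity of germs of meromorphic functions at every point
      (∀ s₀ : ℂ, ∀ᶠ s in 𝓝[≠] s₀, ZetaPQ.FunctionalEquation f s) ∧
      -- and pointwise, wherever no factor of the right-hand side has a pole
      (∀ s : ℂ, (∀ m : ℕ, s + 1 ≠ -(m : ℂ)) → (∀ m : ℕ, s + ((p + q : ℕ) : ℂ) / 2 ≠ -(m : ℂ)) →
        (∀ ε : ZetaPQ.Parity,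
          AnalyticAt ℂ (ZetaPQ.Z ε f) (-s - ((p + q : ℕ) : ℂ) / 2)) →
        ZetaPQ.FunctionalEquation f s) := by
  have hn : 0 < p + q := by omega
  exact ⟨fun ε f => ⟨fun _ hs => ZetaPQ.integrable_mul_detPow ε f hs,
    ZetaPQ.isZetaContinuation_Z hn ε f⟩, fun f =>
    ⟨fun s₀ => ZetaPQ.eventually_functionalEquation hn f s₀,
      fun _ h1 h2 h3 => ZetaPQ.functionalEquation_of_analyticAt hn f h1 h2 h3⟩⟩
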